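/- Let $X$ and $Y$ be real Banach spaces with $X$ reflexive, let $C\subset Y$ be a nonempty closed convex cone, let $\Omega\subseteq X$, and let $F:\Omega\to Y$ be continuous on $\Omega$ and analytic in $\operatorname{int}\Omega$. Let $x_0\in\Omega$. Notation. For $z\in\operatorname{int}\Omega$ let $T_z d:=F'(z)d-C$ for $d\in X$, so that $T_z^{-1}y=\{d\in X: F'(z)d-y\in C\}$ for $y\in Y$. For a subset $S$ of a normed space put $\|S\|:=\inf\{\|v\|: v\in S\}$, with $\|\varnothing\|=+\infty$. For $n\ge 1$ let $\|T_{x_0}^{-1}F^{(n)}(x_0)\|$ be the supremum of $\|T_{x_0}^{-1}(F^{(n)}(x_0)(v_1,\dots,v_n))\|$ over all $v_1,\dots,v_n\in X$ with $\|v_i\|\le 1$ and $T_{x_0}^{-1}(F^{(n)}(x_0)(v_1,\dots,v_n))\ne\varnothing$. Assume: (i) (Robinson's condition) $\bigcup_{d\in X}T_{x_0}d=Y$; (ii) (affine invariant Smale condition with constant $\gamma$ at $x_0$) $0<\gamma<\infty$, $B(x_0,1/\gamma)\subset\Omega$ and $\gamma=\sup_{n>1}\left\|\frac{T_{x_0}^{-1}F^{(n)}(x_0)}{n!}\right\|^{1/(n-1)}$;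 (iii) $b>0$, $\|T_{x_0}^{-1}[-F(x_0)]\|\le b$ and $b\gamma<3-2\sqrt2$; (iv) $0\le\theta\le\dfrac{1-2\sqrt{\gamma b}-\gamma b}{1+2\sqrt{\gamma b}+\gamma b}$. The inexact Newton method with starting point $x_0$ and tolerance $\theta$ takes, for $k=0,1,\dots$, some $r_k\in Y$ and $d_k\in X$ with $$\max_{w\in\{-r_k,r_k\}}\|T_{x_0}^{-1}w\|\le\theta\,\|T_{x_0}^{-1}[-F(x_k)]\|,\qquad d_k\in\operatorname{argmin}\{\|d\|: d\in X,\ F(x_k)+F'(x_k)d+r_k\in C\},$$ and sets $x_{k+1}:=x_k+d_k$. Put $\lambda:=b/(\sqrt{\gamma b}+\gamma b)$ and $f(t):=t/(1-\gamma t)-2t+b$ for $t\in[0,1/\gamma)$. Then the method is well defined for any particular choice of the $r_k$ and $d_k$: however the previous iterations have been chosen, $x_k\in\operatorname{int}\Omega$, and for every $r_k$ satisfying the residual condition the set of minimizers defining $d_k$ is nonempty; in particular the method generates at least one infinite sequence. Every sequence $\{x_k\}$ generated by the method satisfies $$\|T_{x_0}^{-1}[-F(x_k)]\|\le\left(\frac{1+\theta^2}{2}\right)^k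 b,\qquad k=0,1,\dots,$$ is contained in $B(x_0,\lambda)$, and converges to a point $x_*\in B[x_0,\lambda]$ with $x_*\in\Omega$ and $F(x_*)\in C$. Moreover $$\|x_k-x_{k+1}\|\le\frac{1+\theta}{1-\theta}\left[\frac{1+\theta}{2}\,\frac{D^-f'(\lambda)}{|f'(\lambda)|}\,\|x_{k-1}-x_k\|+\theta\,\frac{2+f'(\lambda)}{|f'(\lambda)|}\right]\|x_{k-1}-x_k\|,\qquad k=1,2,\dots,$$ where $D^-f'$ is the left derivative of $f'$. If, additionally, $$\theta<\frac{-2(2-2\sqrt{\gamma b}-\gamma b)+\sqrt{5\gamma^2b^2-44\sqrt{\gamma b}+20\gamma b\sqrt{\gamma b}-2\gamma b+21}}{5-2\sqrt{\gamma b}-\gamma b},$$ then $\{x_k\}$ converges $Q$-linearly: $$\limsup_{k\to\infty}\frac{\|x_*-x_{k+1}\|}{\|x_*-x_k\|}\le\frac{1+\theta}{1-\theta}\left[\frac{1+\theta}{2}+\frac{2\theta}{1-2\sqrt{\gamma b}-\gamma b}\right]<1,$$ where a quotient $0/0$ counts as $0$. -/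

import Mathlib

open Filter Topology Set
open scoped ENNReal

noncomputable section

namespace ConeNewton

/-- The number `‖S‖ = inf {‖v‖ : v ∈ S}` attached to a set `S`, with the convention `‖∅‖ = +∞`. -/
def setNorm {W : Type*} [NormedAddCommGroup W] (S : Set W) : ℝ≥0∞ :=
  ⨅ v ∈ S, ‖v‖ₑ

/-- The (inner) norm of a set-valued mapping,
`‖U‖ = sup {‖U d‖ : d ∈ dom U, ‖d‖ ≤ 1}`, where `‖U d‖ = inf {‖v‖ : v ∈ U d}`. -/
def processNorm {Z W : Type*} [NormedAddCommGroup Z] [NormedAddCommGroup W]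
    (U : Z → Set W) : ℝ≥0∞ :=
  ⨆ (d : Z) (_ : (U d).Nonempty) (_ : ‖d‖ ≤ 1), setNorm (U d)

variable {X Y : Type*} [NormedAddCommGroup X] [NormedSpace ℝ X]
  [NormedAddCommGroup Y] [NormedSpace ℝ Y]

/-- The convex process `T_z d = F'(z) d - C`. -/
def T (F : X → Y) (C : ConvexCone ℝ Y) (z : X) (d : X) : Set Y :=
  {y | ∃ c ∈ C, y = fderiv ℝ F z d - c}

/-- The inverse process `T_z⁻¹ y = {d : y ∈ T_z d} = {d : F'(z) d - y ∈ C}`. -/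
def Tinv (F : X → Y) (C : ConvexCone ℝ Y) (z : X) (y : Y) : Set X :=
  {d | fderiv ℝ F z d - y ∈ C}

theorem mem_Tinv_iff (F : X → Y) (C : ConvexCone ℝ Y) (z d : X) (y : Y) :
    d ∈ Tinv F C z y ↔ y ∈ T F C z d := by
  constructor
  · intro h
    exact ⟨fderiv ℝ F z d - y, h, by abel⟩
  · rintro ⟨c, hc, rfl⟩
    simpa [Tinv] using hc

/-- Robinson's condition at `z`: the range of `T_z` is the whole space `Y`. -/
def Robinson (F : X → Y) (C : ConvexCone ℝ Y) (z : X) : Prop :=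
  ∀ y : Y, ∃ d : X, y ∈ T F C z d

/-- The affine invariant Smale condition with constant `γ` at `x₀` for a mapping
`F` on `Ω`. The `n`-th derivative `F⁽ⁿ⁾(x₀)` is an `n`-linear map, and `Fin n → X` carries the
maximum norm, so that the norm of `T_{x₀}⁻¹ F⁽ⁿ⁾(x₀)` is the supremum of
`‖T_{x₀}⁻¹ (F⁽ⁿ⁾(x₀)(v₁, …, vₙ))‖` over all `v₁, …, vₙ` of norm at most one. -/
structure Smale (F : X → Y) (Ω : Set X) (C : ConvexCone ℝ Y) (x₀ : X) (γ : ℝ) : Prop where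
  continuousOn : ContinuousOn F Ω
  analyticOn : AnalyticOnNhd ℝ F (interior Ω)
  pos : 0 < γ
  ball_subset : Metric.ball x₀ (1 / γ) ⊆ Ω
  sup_eq : ⨆ (n : ℕ) (_ : 1 < n),
      (processNorm (fun v : Fin n → X => Tinv F C x₀ (iteratedFDeriv ℝ n F x₀ v))
        / (n.factorial : ℝ≥0∞)) ^ (1 / ((n : ℝ) - 1)) = ENNReal.ofReal γ

/-- `r` is an admissible residual at `x` with relative error tolerance `θ`:
`max_{w ∈ {-r, r}} ‖T_{x₀}⁻¹ w‖ ≤ θ ‖T_{x₀}⁻¹ [-F(x)]‖`. -/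
def IsResidual (F : X → Y) (C : ConvexCone ℝ Y) (x₀ : X) (θ : ℝ) (x : X) (r : Y) : Prop :=
  max (setNorm (Tinv F C x₀ (-r))) (setNorm (Tinv F C x₀ r)) ≤
    ENNReal.ofReal θ * setNorm (Tinv F C x₀ (-F x))

/-- `d ∈ argmin {‖d‖ : F(x) + F'(x) d + r ∈ C}`. -/
def IsStep (F : X → Y) (C : ConvexCone ℝ Y) (x : X) (r : Y) (d : X) : Prop :=
  F x + fderiv ℝ F x d + r ∈ C ∧
    ∀ d' : X, F x + fderiv ℝ F x d' + r ∈ C → ‖d‖ ≤ ‖d'‖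

/-- `x'` is obtained from `x` by one iteration of the inexact Newton method. -/
def IsIteration (F : X → Y) (C : ConvexCone ℝ Y) (x₀ : X) (θ : ℝ) (x x' : X) : Prop :=
  ∃ (r : Y) (d : X), IsResidual F C x₀ θ x r ∧ IsStep F C x r d ∧ x' = x + d

/-- `x` is a sequence generated by the inexact Newton method with starting point `x₀` and
residual relative error tolerance `θ`. -/
def IsNewtonSeq (F : X → Y) (C : ConvexCone ℝ Y) (x₀ : X) (θ : ℝ) (x : ℕ → X) : Prop :=
  x 0 = x₀ ∧ ∀ k, IsIteration F C x₀ θ (x k) (x (k + 1))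

end ConeNewton

/-- The majorant function `f(t) = t / (1 - γ t) - 2 t + b`, used on `[0, 1/γ)`. -/
def smaleMajorant (γ b t : ℝ) : ℝ := t / (1 - γ * t) - 2 * t + b

end

/-! Write `p y` for the least norm of a `d` with `F'(x₀) d - y ∈ C`. Reflexivity makes `p` attained
and lower semicontinuous, and `p` is sublinear and vanishes on `-C`. By Robinson's condition it is
finite, so the seminorm `max (p y) (p (-y))` is continuous on the Banach space `Y`. Hahn–Banach then
gives `p y = φ y` for some continuous `φ ≤ p` (`exists_dual_eq`), and estimates on `F` reduce to
estimates on the scalar functions `φ ∘ F`.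

For these, Smale's condition bounds the `n`-th derivative at `x₀` by `n! γ ^ (n - 1)`. Summing the
Taylor series bounds the second derivative at `z` by `f''(‖z - x₀‖)`. Integrating once controls
`F'(z) - F'(x₀)`, and a Neumann series for convex processes (`exists_perturb`) yields solvability at
`z` with constant `1 / -f'(‖z - x₀‖)`. Integrating twice bounds the linearization error of `F` by
that of `f`.

The iterates are compared with scalar pairs `(t, ε)`: `t` bounds `‖x_k - x₀‖` and `f t + ε` bounds
`p (-F x_k)`, where `ε` accumulates the inexactness. With `κ = -f'(lam)`, the region `t < lam`, `ε ≤
κ t` is invariant and `f t + ε` shrinks by `(1 + θ²) / 2` at each step (`majStep_spec`). This gives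
well-definedness, the residual bound and convergence.

For the linear rate, residuals eventually contract by any factor `θ' > θ`. Summing the remaining
steps bounds the distance to the limit by the residual, and the mean value inequality bounds the
residual by the previous distance. -/

noncomputable section

namespace ConeNewton

/-! ### Weak compactness in reflexive spaces -/

section Reflexive

variable {X : Type*} [NormedAddCommGroup X] [NormedSpace ℝ X]

/-- In a reflexive space, a decreasing sequence of nonempty bounded closed convex sets has a common
point. -/
theorem nonempty_iInter_of_reflexive
    (hX : Function.Surjective (NormedSpace.inclusionInDoubleDual ℝ X))
    (S : ℕ → Set X) (hanti : ∀ n, S (n + 1) ⊆ S n) (hne : ∀ n, (S n).Nonempty)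
    (hconv : ∀ n, Convex ℝ (S n)) (hcl : ∀ n, IsClosed (S n))
    (hbd : Bornology.IsBounded (S 0)) : (⋂ n, S n).Nonempty := by
  -- Mazur: a norm-closed convex set is weakly closed.
  have hcl' : ∀ n, IsClosed (toWeakSpace ℝ X '' S n) := fun n => by
    have h := (hconv n).toWeakSpace_closure ℝ
    rw [(hcl n).closure_eq] at h
    rw [h]
    exact isClosed_closure
  have hcomp : IsCompact (toWeakSpace ℝ X '' S 0) := by
    have h := NormedSpace.isCompact_closure_of_isBounded ℝ X (toWeakSpace ℝ X '' S 0) ?_ ?_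
    · rwa [(hcl' 0).closure_eq] at h
    · rwa [preimage_image_eq _ (toWeakSpace ℝ X).injective]
    -- Reflexivity enters here: every element of the bidual comes from `X`, so no weak limit point
    -- is lost.
    · rintro ξ -
      obtain ⟨x, hx⟩ := hX (WeakDual.toStrongDual ξ)
      refine ⟨toWeakSpace ℝ X x, ?_⟩
      exact DFunLike.ext _ _ fun l => DFunLike.congr_fun hx l
  obtain ⟨w, hw⟩ := IsCompact.nonempty_iInter_of_sequence_nonempty_isCompact_isClosed
    (fun n => toWeakSpace ℝ X '' S n) (fun n => image_mono (hanti n))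
    (fun n => (hne n).image _) hcomp hcl'
  refine ⟨(toWeakSpace ℝ X).symm w, mem_iInter.2 fun n => ?_⟩
  obtain ⟨x, hx, rfl⟩ := mem_iInter.1 hw n
  simpa using hx

/-- In a reflexive space, a nonempty closed convex set has an element of least norm. -/
theorem exists_forall_norm_le_of_reflexive
    (hX : Function.Surjective (NormedSpace.inclusionInDoubleDual ℝ X))
    {S : Set X} (hne : S.Nonempty) (hconv : Convex ℝ S) (hcl : IsClosed S) :
    ∃ d ∈ S, ∀ d' ∈ S, ‖d‖ ≤ ‖d'‖ := by
  set m := sInf (norm '' S)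
  have hbelow : BddBelow (norm '' S) := ⟨0, by rintro _ ⟨d, -, rfl⟩; exact norm_nonneg d⟩
  have hm : ∀ d ∈ S, m ≤ ‖d‖ := fun d hd => csInf_le hbelow (mem_image_of_mem _ hd)
  have hδ : ∀ n : ℕ, (0 : ℝ) < 1 / (n + 1) := fun n => Nat.one_div_pos_of_nat
  obtain ⟨d, hd⟩ := nonempty_iInter_of_reflexive hX
    (fun n : ℕ => S ∩ Metric.closedBall 0 (m + 1 / ((n : ℝ) + 1)))
    (fun n => inter_subset_inter_right _ (Metric.closedBall_subset_closedBall (by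
      have := Nat.one_div_le_one_div (α := ℝ) (Nat.le_succ n)
      push_cast at this ⊢
      linarith)))
    (fun n => by
      obtain ⟨_, ⟨d, hd, rfl⟩, hlt⟩ := exists_lt_of_csInf_lt (hne.image norm)
        (lt_add_of_pos_right m (hδ n))
      exact ⟨d, hd, by simpa using hlt.le⟩)
    (fun n => hconv.inter (convex_closedBall _ _))
    (fun n => hcl.inter Metric.isClosed_closedBall)
    (Metric.isBounded_closedBall.subset inter_subset_right)
  rw [mem_iInter] at hd
  refine ⟨d, (hd 0).1, fun d' hd' => ?_⟩
  have hlim : Tendsto (fun n : ℕ => m + 1 / ((n : ℝ) + 1)) atTop (𝓝 (m + 0)) :=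
    tendsto_const_nhds.add tendsto_one_div_add_atTop_nhds_zero_nat
  rw [add_zero] at hlim
  exact (ge_of_tendsto' hlim fun n => by simpa using (hd n).2).trans (hm d' hd')

end Reflexive

/-! ### The inverse of a convex process: sublinearity, duality, perturbation -/

section ConvexProcess

variable {X Y : Type*} [NormedAddCommGroup X] [NormedSpace ℝ X]
  [NormedAddCommGroup Y] [NormedSpace ℝ Y]

/-- The least norm of a solution `d` of the inclusion `A d - y ∈ C`. -/
def procNorm (A : X →L[ℝ] Y) (C : ConvexCone ℝ Y) (y : Y) : ℝ :=
  sInf (norm '' {d | A d - y ∈ C})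

/-- The inclusion `A d - y ∈ C`, with `X` reflexive and `C` a closed cone, is solvable for
all `y`. -/
structure RegularProcess (A : X →L[ℝ] Y) (C : ConvexCone ℝ Y) : Prop where
  reflexive : Function.Surjective (NormedSpace.inclusionInDoubleDual ℝ X)
  zero_mem : (0 : Y) ∈ C
  closed : IsClosed (C : Set Y)
  surj : ∀ y, ∃ d, A d - y ∈ C

theorem zero_mem_of_closed_cone {C : ConvexCone ℝ Y} (hne : (C : Set Y).Nonempty)
    (hcl : IsClosed (C : Set Y)) : (0 : Y) ∈ C := by
  obtain ⟨c, hc⟩ := hne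
  have hlim : Tendsto (fun n : ℕ => (1 / ((n : ℝ) + 1)) • c) atTop (𝓝 ((0 : ℝ) • c)) :=
    tendsto_one_div_add_atTop_nhds_zero_nat.smul_const c
  rw [zero_smul] at hlim
  exact hcl.mem_of_tendsto hlim (Eventually.of_forall fun n =>
    C.smul_mem (Nat.one_div_pos_of_nat) hc)

theorem convex_preimage_sub (A : X →L[ℝ] Y) {K : Set Y} (hK : Convex ℝ K) (y : Y) :
    Convex ℝ {d | A d - y ∈ K} := by
  intro d₁ h₁ d₂ h₂ a b ha hb hab
  have h := hK h₁ h₂ ha hb hab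
  have hy : y = a • y + b • y := by rw [← add_smul, hab, one_smul]
  have e : A (a • d₁ + b • d₂) - y = a • (A d₁ - y) + b • (A d₂ - y) := by
    conv_lhs => rw [hy]
    simp only [map_add, map_smul, smul_sub]
    abel
  change A (a • d₁ + b • d₂) - y ∈ K
  rwa [e]

theorem isClosed_preimage_sub (A : X →L[ℝ] Y) {K : Set Y} (hK : IsClosed K) (y : Y) :
    IsClosed {d | A d - y ∈ K} :=
  hK.preimage (A.continuous.sub continuous_const)

theorem procNorm_nonneg (A : X →L[ℝ] Y) (C : ConvexCone ℝ Y) (y : Y) : 0 ≤ procNorm A C y :=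
  Real.sInf_nonneg (by rintro _ ⟨d, -, rfl⟩; exact norm_nonneg d)

theorem procNorm_le {A : X →L[ℝ] Y} {C : ConvexCone ℝ Y} {y : Y} {d : X} (h : A d - y ∈ C) :
    procNorm A C y ≤ ‖d‖ :=
  csInf_le ⟨0, by rintro _ ⟨d, -, rfl⟩; exact norm_nonneg d⟩ (mem_image_of_mem _ h)

namespace RegularProcess

variable {A : X →L[ℝ] Y} {C : ConvexCone ℝ Y}

theorem exists_norm_eq (h : RegularProcess A C) (y : Y) :
    ∃ d, A d - y ∈ C ∧ ‖d‖ = procNorm A C y := by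
  obtain ⟨d, hd, hmin⟩ := exists_forall_norm_le_of_reflexive h.reflexive (h.surj y)
    (convex_preimage_sub A C.convex y) (isClosed_preimage_sub A h.closed y)
  refine ⟨d, hd, le_antisymm ?_ (procNorm_le hd)⟩
  exact le_csInf ⟨_, d, hd, rfl⟩ (by rintro _ ⟨d', hd', rfl⟩; exact hmin d' hd')

theorem procNorm_add (h : RegularProcess A C) (y z : Y) :
    procNorm A C (y + z) ≤ procNorm A C y + procNorm A C z := by
  obtain ⟨d, hd, hdn⟩ := h.exists_norm_eq y
  obtain ⟨e, he, hen⟩ := h.exists_norm_eq z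
  rw [← hdn, ← hen]
  refine (procNorm_le (d := d + e) ?_).trans (norm_add_le d e)
  have := C.add_mem hd he
  rwa [show A (d + e) - (y + z) = A d - y + (A e - z) by rw [map_add]; abel]

theorem _root_.ConeNewton.procNorm_neg_of_mem {c : Y} (hc : c ∈ C) : procNorm A C (-c) = 0 :=
  le_antisymm ((procNorm_le (d := 0) (by simpa using hc)).trans_eq norm_zero)
    (procNorm_nonneg _ _ _)

theorem procNorm_zero (h : RegularProcess A C) : procNorm A C 0 = 0 := by
  simpa using procNorm_neg_of_mem (A := A) h.zero_mem

theorem procNorm_map_le (h : RegularProcess A C) (v : X) : procNorm A C (A v) ≤ ‖v‖ :=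
  procNorm_le (by simpa using h.zero_mem)

theorem procNorm_smul_le (h : RegularProcess A C) {c : ℝ} (hc : 0 < c) (y : Y) :
    procNorm A C (c • y) ≤ c * procNorm A C y := by
  obtain ⟨d, hd, hdn⟩ := h.exists_norm_eq y
  refine (procNorm_le (d := c • d) ?_).trans_eq ?_
  · rw [map_smul, ← smul_sub]
    exact C.smul_mem hc hd
  · rw [norm_smul, Real.norm_of_nonneg hc.le, hdn]

theorem procNorm_smul (h : RegularProcess A C) {c : ℝ} (hc : 0 < c) (y : Y) :
    procNorm A C (c • y) = c * procNorm A C y := by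
  refine le_antisymm (h.procNorm_smul_le hc y) ?_
  have := h.procNorm_smul_le (inv_pos.2 hc) (c • y)
  rw [smul_smul, inv_mul_cancel₀ hc.ne', one_smul] at this
  rwa [← le_inv_mul_iff₀ hc]

/-- Lower semicontinuity of the least norm. For `y` in the closure, the sets of `d` with `‖d‖ ≤ a`
that solve the inclusion up to an error `1 / (n + 1)` are nonempty, nested, closed and convex; a
common point solves it exactly because `C` is closed. -/
theorem isClosed_procNorm_le (h : RegularProcess A C) (a : ℝ) :
    IsClosed {y | procNorm A C y ≤ a} := by
  refine isClosed_of_closure_subset fun y hy => ?_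
  obtain ⟨d, hd⟩ := nonempty_iInter_of_reflexive h.reflexive
    (fun n : ℕ => Metric.closedBall 0 a ∩
      {d | A d - y ∈ Metric.cthickening (1 / ((n : ℝ) + 1)) (C : Set Y)})
    (fun n => inter_subset_inter_right _ fun d hd => Metric.cthickening_mono (by
      have := Nat.one_div_le_one_div (α := ℝ) (Nat.le_succ n)
      push_cast at this ⊢
      linarith) _ hd)
    (fun n => by
      obtain ⟨y', hy', hdist⟩ := Metric.mem_closure_iff.1 hy _
        (Nat.one_div_pos_of_nat (α := ℝ) (n := n))
      obtain ⟨d, hd, hdn⟩ := h.exists_norm_eq y'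
      refine ⟨d, by simpa [hdn] using hy', Metric.mem_cthickening_of_dist_le _ _ _ _ hd ?_⟩
      rw [dist_sub_left]
      exact hdist.le)
    (fun n => (convex_closedBall _ _).inter (convex_preimage_sub A (C.convex.cthickening _) y))
    (fun n => Metric.isClosed_closedBall.inter
      (isClosed_preimage_sub A Metric.isClosed_cthickening y))
    (Metric.isBounded_closedBall.subset inter_subset_left)
  rw [mem_iInter] at hd
  have hmem : A d - y ∈ C := by
    have : A d - y ∈ closure (C : Set Y) := by
      rw [Metric.closure_eq_iInter_cthickening]
      refine mem_iInter₂.2 fun δ hδ => ?_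
      obtain ⟨n, hn⟩ := exists_nat_one_div_lt hδ
      exact Metric.cthickening_mono hn.le _ (hd n).2
    rwa [h.closed.closure_eq] at this
  exact (procNorm_le hmem).trans (by simpa using (hd 0).1)

/-- The seminorm `max {‖A⁻¹ y‖, ‖A⁻¹ (-y)‖}`. -/
def seminorm (h : RegularProcess A C) : Seminorm ℝ Y :=
  Seminorm.of (fun y => max (procNorm A C y) (procNorm A C (-y)))
    (fun y z => by
      refine max_le ((h.procNorm_add y z).trans (add_le_add (le_max_left _ _) (le_max_left _ _))) ?_
      rw [neg_add]
      exact (h.procNorm_add _ _).trans (add_le_add (le_max_right _ _) (le_max_right _ _)))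
    (fun c y => by
      rcases lt_trichotomy c 0 with hc | rfl | hc
      · have e₁ : c • y = (-c) • (-y) := by simp
        have e₂ : -(c • y) = (-c) • y := by simp
        rw [e₂, e₁, h.procNorm_smul (neg_pos.2 hc), h.procNorm_smul (neg_pos.2 hc),
          ← mul_max_of_nonneg _ _ (neg_pos.2 hc).le, max_comm, Real.norm_of_nonpos hc.le]
      · simp [h.procNorm_zero]
      · rw [← smul_neg, h.procNorm_smul hc, h.procNorm_smul hc, ← mul_max_of_nonneg _ _ hc.le,
          Real.norm_of_nonneg hc.le])

/-- A lower semicontinuous seminorm on a Banach space is continuous, by Baire. The least norm is not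
symmetric, hence the maximum over both signs. -/
theorem continuous_seminorm [CompleteSpace Y] (h : RegularProcess A C) :
    Continuous h.seminorm := by
  refine Seminorm.continuous_of_lowerSemicontinuous _ ?_
  rw [lowerSemicontinuous_iff_isClosed_preimage]
  intro a
  have : h.seminorm ⁻¹' Iic a =
      {y | procNorm A C y ≤ a} ∩ Neg.neg ⁻¹' {y | procNorm A C y ≤ a} := by
    ext y
    exact max_le_iff (α := ℝ)
  rw [this]
  exact (h.isClosed_procNorm_le a).inter ((h.isClosed_procNorm_le a).preimage continuous_neg)

/-- The least norm is the support function of the continuous linear functionals it dominates. -/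
theorem exists_dual_eq [CompleteSpace Y] (h : RegularProcess A C) (y : Y) :
    ∃ φ : StrongDual ℝ Y, (∀ z, φ z ≤ procNorm A C z) ∧ φ y = procNorm A C y := by
  have key : ∃ g : Y →ₗ[ℝ] ℝ, (∀ z, g z ≤ procNorm A C z) ∧ g y = procNorm A C y := by
    rcases eq_or_ne y 0 with rfl | hy
    · exact ⟨0, fun z => procNorm_nonneg _ _ _, by simp [h.procNorm_zero]⟩
    · obtain ⟨g, hg, hle⟩ := exists_extension_of_le_sublinear
        (LinearPMap.mkSpanSingleton y (procNorm A C y) hy) (procNorm A C)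
        (fun c hc z => h.procNorm_smul hc z) h.procNorm_add (by
          rintro ⟨z, hz⟩
          obtain ⟨c, rfl⟩ := Submodule.mem_span_singleton.1 hz
          rw [LinearPMap.mkSpanSingleton'_apply]
          change c * procNorm A C y ≤ procNorm A C (c • y)
          rcases lt_trichotomy c 0 with hc | rfl | hc
          · exact (mul_nonpos_of_nonpos_of_nonneg hc.le (procNorm_nonneg _ _ _)).trans
              (procNorm_nonneg _ _ _)
          · simp [h.procNorm_zero]
          · rw [h.procNorm_smul hc])
      refine ⟨g, hle, ?_⟩
      have := hg ⟨y, Submodule.mem_span_singleton_self y⟩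
      rw [this]
      exact LinearPMap.mkSpanSingleton_apply ..
  obtain ⟨g, hg, hgy⟩ := key
  -- The algebraic extension is automatically continuous, being dominated by a continuous seminorm.
  have habs : ∀ z, ‖g z‖ ≤ h.seminorm z := fun z => by
    rw [Real.norm_eq_abs, abs_le']
    refine ⟨(hg z).trans (le_max_left _ _), ?_⟩
    rw [← map_neg]
    exact (hg (-z)).trans (le_max_right _ _)
  have hcont : Continuous g := by
    refine continuous_of_continuousAt_zero g ?_
    have hz : Tendsto h.seminorm (𝓝 0) (𝓝 0) := by
      simpa using h.continuous_seminorm.tendsto 0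
    simpa [ContinuousAt] using squeeze_zero_norm habs hz
  exact ⟨⟨g, hcont⟩, hg, hgy⟩

/-- Solvability of the inclusion is stable under perturbations of `A` that are small relative
to the process. -/
theorem exists_perturb [CompleteSpace X] (h : RegularProcess A C) {B : X →L[ℝ] Y} {M : ℝ}
    (hM0 : 0 ≤ M) (hM1 : M < 1) (hB : ∀ v, procNorm A C (B v) ≤ M * ‖v‖) (y : Y) :
    ∃ d, (A + B) d - y ∈ C ∧ ‖d‖ ≤ procNorm A C y / (1 - M) := by
  choose sel hsel hseln using h.exists_norm_eq
  -- Neumann series: each correction absorbs the error `B (d n)` left by its predecessor, so the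
  -- partial sums solve the perturbed inclusion up to the last such error.
  let d : ℕ → X := fun n => Nat.rec (sel y) (fun _ v => sel (-B v)) n
  have hd0 : d 0 = sel y := rfl
  have hds : ∀ n, d (n + 1) = sel (-B (d n)) := fun n => rfl
  have hdn : ∀ n, ‖d n‖ ≤ procNorm A C y * M ^ n := by
    intro n
    induction n with
    | zero => simp [hd0, hseln]
    | succ n ih =>
      rw [hds, hseln, ← map_neg]
      refine (hB _).trans ?_
      rw [norm_neg, pow_succ, ← mul_assoc, mul_comm M]
      exact mul_le_mul_of_nonneg_right ih hM0
  have hgeo : HasSum (fun n => procNorm A C y * M ^ n) (procNorm A C y * (1 - M)⁻¹) :=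
    (hasSum_geometric_of_lt_one hM0 hM1).mul_left _
  have hsum : Summable d := Summable.of_norm_bounded hgeo.summable hdn
  have hpart : ∀ n, (A + B) (∑ i ∈ Finset.range (n + 1), d i) - y - B (d n) ∈ C := by
    intro n
    induction n with
    | zero =>
      have := hsel y
      simpa [hd0, add_sub_right_comm] using this
    | succ n ih =>
      have := C.add_mem ih (hsel (-B (d n)))
      rw [← hds] at this
      convert this using 1
      rw [Finset.sum_range_succ _ (n + 1), map_add]
      simp only [add_apply]
      abel
  refine ⟨∑' n, d n, ?_, ?_⟩
  · have h1 : Tendsto (fun n => ∑ i ∈ Finset.range (n + 1), d i) atTop (𝓝 (∑' n, d n)) :=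
      hsum.hasSum.tendsto_sum_nat.comp (tendsto_add_atTop_nat 1)
    have h2 : Tendsto (fun n => (A + B) (∑ i ∈ Finset.range (n + 1), d i) - y - B (d n)) atTop
        (𝓝 ((A + B) (∑' n, d n) - y - B 0)) :=
      ((((A + B).continuous.tendsto _).comp h1).sub_const y).sub
        ((B.continuous.tendsto _).comp hsum.tendsto_atTop_zero)
    rw [map_zero, sub_zero] at h2
    exact h.closed.mem_of_tendsto h2 (Eventually.of_forall hpart)
  · rw [div_eq_mul_inv, ← hgeo.tsum_eq]
    exact tsum_of_norm_bounded hgeo.summable.hasSum hdn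

end RegularProcess

end ConvexProcess

/-! ### From derivatives at the centre to second derivatives in the ball -/

section Analytic

/-- If the derivatives of `h` at `0` grow at most like `K (n + 2)! aⁿ`, the Taylor series bounds
`h 1`. -/
theorem abs_apply_one_le {h : ℝ → ℝ} {K a ρ : ℝ} (ha : 0 ≤ a) (hρ : 1 < ρ) (haρ : a * ρ < 1)
    (hh : AnalyticOnNhd ℝ h (Metric.ball 0 ρ))
    (hb : ∀ n : ℕ, |iteratedDeriv n h 0| ≤ K * ((n + 2).factorial * a ^ n)) :
    |h 1| ≤ K * (2 / (1 - a) ^ 3) := by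
  have ha1 : a < 1 := lt_of_le_of_lt (le_mul_of_one_le_right ha hρ.le) haρ
  have hfac : ∀ n : ℕ, ((n + 2).factorial : ℝ) = 2 * (n + 2).choose 2 * n.factorial := fun n => by
    have := Nat.add_choose_mul_factorial_mul_factorial n 2
    have h2 : ((n + 2).choose 2 * n.factorial * (2 : ℕ).factorial : ℝ) = (n + 2).factorial := by
      exact_mod_cast this
    rw [← h2]
    simp [Nat.factorial]
    ring
  have hcoef : ∀ n : ℕ, |iteratedDeriv n h 0 / n.factorial| ≤
      K * 2 * ((n + 2).choose 2 * a ^ n) := fun n => by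
    have hn : (0 : ℝ) < n.factorial := by exact_mod_cast n.factorial_pos
    rw [abs_div, abs_of_pos hn, div_le_iff₀ hn]
    refine (hb n).trans_eq ?_
    rw [hfac]
    ring
  set p := FormalMultilinearSeries.ofScalars ℝ (fun n ↦ iteratedDeriv n h 0 / n.factorial) with hp
  -- Needed twice: `c = a * ρ` shows that the Taylor series has radius at least `ρ`, and `c = a`
  -- bounds its sum at `1`.
  have hgeo : ∀ c : ℝ, 0 ≤ c → c < 1 →
      HasSum (fun n : ℕ => K * 2 * ((n + 2).choose 2 * c ^ n)) (K * 2 * (1 / (1 - c) ^ 3)) :=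
    fun c h0 h1 => by
      have := (hasSum_choose_mul_geometric_of_norm_lt_one (𝕜 := ℝ) 2 (r := c)
        (by rwa [Real.norm_of_nonneg h0])).mul_left (K * 2)
      rwa [show 2 + 1 = 3 from rfl] at this
  have hrad : ((ρ.toNNReal : NNReal) : ℝ≥0∞) ≤ p.radius := by
    refine p.le_radius_of_summable_norm ?_
    refine Summable.of_norm_bounded (hgeo (a * ρ) (by positivity) haρ).summable fun n => ?_
    rw [FormalMultilinearSeries.ofScalars_norm, Real.coe_toNNReal _ (by linarith), norm_mul,
      norm_norm, Real.norm_eq_abs, norm_pow, Real.norm_of_nonneg (by linarith : 0 ≤ ρ), mul_pow,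
      ← mul_assoc, ← mul_assoc, mul_assoc (K * 2)]
    exact mul_le_mul_of_nonneg_right (hcoef n) (by positivity)
  have hball : Metric.eball (0 : ℝ) ((ρ.toNNReal : NNReal) : ℝ≥0∞) = Metric.ball 0 ρ := by
    rw [Metric.eball_coe, Real.coe_toNNReal _ (by linarith)]
  have hser : HasFPowerSeriesOnBall h p 0 ((ρ.toNNReal : NNReal) : ℝ≥0∞) :=
    AnalyticOn.hasFPowerSeriesOnSubball (by rw [ENNReal.coe_pos, Real.toNNReal_pos]; linarith)
      (by rw [hball]; exact hh.analyticOn) hrad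
  have h1 := hser.hasSum (y := 1) (by rw [hball]; simpa using hρ)
  rw [zero_add] at h1
  rw [← h1.tsum_eq, ← Real.norm_eq_abs]
  refine (tsum_of_norm_bounded (hgeo a ha ha1) fun n => ?_).trans_eq (by ring)
  rw [hp, FormalMultilinearSeries.ofScalars_apply_eq]
  simpa [abs_div] using hcoef n

variable {X : Type*} [NormedAddCommGroup X]

/-- The arguments `(u, …, u, v, w)`. -/
def dirs (u v w : X) : (m : ℕ) → Fin (m + 2) → X
  | 0 => ![v, w]
  | m + 1 => Fin.cons u (dirs u v w m)

theorem prod_norm_dirs (u v w : X) (m : ℕ) :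
    ∏ i, ‖dirs u v w m i‖ = ‖u‖ ^ m * (‖v‖ * ‖w‖) := by
  induction m with
  | zero => simp [dirs, Fin.prod_univ_two]
  | succ m ih =>
    rw [Fin.prod_univ_succ]
    simp only [dirs, Fin.cons_zero, Fin.cons_succ]
    rw [ih]
    ring

variable [NormedSpace ℝ X]

theorem hasDerivAt_line (x d : X) (τ : ℝ) : HasDerivAt (fun τ : ℝ => x + τ • d) d τ := by
  simpa using ((hasDerivAt_id τ).smul_const d).const_add x

/-- A scalar function that is analytic on the ball of radius `1 / γ` about `x₀`, with
derivatives at `x₀` bounded as for `t / (1 - γ t)`. -/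
structure SmaleScalar (g : X → ℝ) (x₀ : X) (γ : ℝ) : Prop where
  pos : 0 < γ
  analytic : AnalyticOnNhd ℝ g (Metric.ball x₀ (1 / γ))
  bound : ∀ n : ℕ, 1 < n → ∀ v : Fin n → X, (∀ i, ‖v i‖ ≤ 1) →
    |iteratedFDeriv ℝ n g x₀ v| ≤ n.factorial * γ ^ (n - 1)

variable {g : X → ℝ} {x₀ : X} {γ : ℝ}

theorem SmaleScalar.norm_iteratedFDeriv_le (hg : SmaleScalar g x₀ γ) {n : ℕ} (hn : 1 < n) :
    ‖iteratedFDeriv ℝ n g x₀‖ ≤ n.factorial * γ ^ (n - 1) := by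
  have := hg.pos
  refine ContinuousMultilinearMap.opNorm_le_bound (by positivity) fun m => ?_
  have hm : m = fun i => ‖m i‖ • (‖m i‖⁻¹ • m i) := by
    funext i
    rcases eq_or_ne (m i) 0 with h | h
    · simp [h]
    · rw [smul_smul, mul_inv_cancel₀ (norm_ne_zero_iff.2 h), one_smul]
  conv_lhs => rw [hm, ContinuousMultilinearMap.map_smul_univ]
  rw [norm_smul, Real.norm_of_nonneg (Finset.prod_nonneg fun i _ => norm_nonneg _), mul_comm]
  refine mul_le_mul_of_nonneg_right (hg.bound n hn _ fun i => ?_)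
    (Finset.prod_nonneg fun i _ => norm_nonneg _)
  rw [norm_smul, norm_inv, norm_norm]
  exact inv_mul_le_one

/-- The function `τ ↦ D²g(x₀ + τ u)(v, w)`, with `u = z - x₀`, has `m`-th derivative `D^(m+2) g (u,
…, u, v, w)`. Its Taylor series at `0` is therefore dominated by that of `f''` along the ray, and
its value at `τ = 1` is the quantity sought. -/
theorem SmaleScalar.abs_fderiv_fderiv_le (hg : SmaleScalar g x₀ γ) {z : X}
    (hz : z ∈ Metric.ball x₀ (1 / γ)) (v w : X) :
    |fderiv ℝ (fderiv ℝ g) z v w| ≤ 2 * γ / (1 - γ * ‖z - x₀‖) ^ 3 * (‖v‖ * ‖w‖) := by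
  have hγ := hg.pos
  set u := z - x₀ with hu
  set a := γ * ‖u‖ with ha
  have ha0 : 0 ≤ a := by positivity
  have ha1 : a < 1 := by
    rw [mem_ball_iff_norm, lt_div_iff₀ hγ] at hz
    rwa [ha, mul_comm]
  -- The radius `2 / (1 + a)` exceeds `1`, while `a * (2 / (1 + a)) < 1` keeps the segment inside
  -- the ball of analyticity.
  have hmem : ∀ τ : ℝ, τ ∈ Metric.ball (0 : ℝ) (2 / (1 + a)) →
      x₀ + τ • u ∈ Metric.ball x₀ (1 / γ) := fun τ hτ => by
    rw [mem_ball_zero_iff, Real.norm_eq_abs, lt_div_iff₀ (by linarith)] at hτ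
    rw [mem_ball_iff_norm, add_sub_cancel_left, norm_smul, Real.norm_eq_abs, lt_div_iff₀ hγ]
    have : |τ| * ‖u‖ * γ = |τ| * a := by rw [ha]; ring
    rw [this]
    nlinarith [abs_nonneg τ]
  let h : ℕ → ℝ → ℝ := fun m τ => iteratedFDeriv ℝ (m + 2) g (x₀ + τ • u) (dirs u v w m)
  have han : ∀ m, AnalyticOnNhd ℝ (h m) (Metric.ball 0 (2 / (1 + a))) := fun m =>
    ((ContinuousMultilinearMap.apply ℝ (fun _ : Fin (m + 2) => X) ℝ
      (dirs u v w m)).comp_analyticOnNhd (hg.analytic.iteratedFDeriv (m + 2))).comp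
        (fun τ _ => by fun_prop) hmem
  have hder : ∀ m, ∀ τ ∈ Metric.ball (0 : ℝ) (2 / (1 + a)),
      HasDerivAt (h m) (h (m + 1) τ) τ := fun m τ hτ => by
    have h1 := ((hg.analytic.iteratedFDeriv (m + 2)) _ (hmem τ hτ)).differentiableAt.hasFDerivAt
    have h2 := h1.comp_hasDerivAt τ (hasDerivAt_line x₀ u τ)
    exact (ContinuousMultilinearMap.apply ℝ (fun _ : Fin (m + 2) => X) ℝ
      (dirs u v w m)).hasFDerivAt.comp_hasDerivAt τ h2
  have hiter : ∀ m, ∀ τ ∈ Metric.ball (0 : ℝ) (2 / (1 + a)), iteratedDeriv m (h 0) τ = h m τ := by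
    intro m
    induction m with
    | zero => intro τ _; simp
    | succ m ih =>
      intro τ hτ
      rw [iteratedDeriv_succ, ← (hder m τ hτ).deriv]
      refine EventuallyEq.deriv_eq ?_
      filter_upwards [Metric.isOpen_ball.mem_nhds hτ] with s hs using ih s hs
  have hρ : 1 < 2 / (1 + a) := by rw [lt_div_iff₀ (by linarith)]; linarith
  have key := abs_apply_one_le (K := γ * (‖v‖ * ‖w‖)) ha0 hρ
    (by rw [mul_div_assoc', div_lt_one (by linarith)]; linarith) (han 0) (fun m => by
      rw [hiter m 0 (by simp; linarith)]
      refine ((iteratedFDeriv ℝ (m + 2) g (x₀ + (0 : ℝ) • u)).le_opNorm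
        (dirs u v w m)).trans ?_
      rw [prod_norm_dirs, zero_smul, add_zero]
      refine (mul_le_mul_of_nonneg_right (hg.norm_iteratedFDeriv_le (by omega))
        (by positivity)).trans_eq ?_
      rw [ha, show m + 2 - 1 = m + 1 by omega]
      ring)
  have e : h 0 1 = fderiv ℝ (fderiv ℝ g) z v w := by
    change iteratedFDeriv ℝ 2 g (x₀ + (1 : ℝ) • u) ![v, w] = _
    rw [iteratedFDeriv_two_apply, one_smul, hu, add_sub_cancel]
    simp
  rw [← e]
  refine key.trans_eq ?_
  ring

end Analytic

/-! ### Comparison with the majorant along segments -/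

section Majorant

/-- The derivative of the majorant function. -/
def majorantDeriv (γ t : ℝ) : ℝ := 1 / (1 - γ * t) ^ 2 - 2

theorem hasDerivAt_smaleMajorant {γ b t : ℝ} (ht : 1 - γ * t ≠ 0) :
    HasDerivAt (smaleMajorant γ b) (majorantDeriv γ t) t := by
  have h1 : HasDerivAt (fun t : ℝ => 1 - γ * t) (-γ) t := by
    simpa using ((hasDerivAt_id t).const_mul γ).const_sub 1
  have h2 := (((hasDerivAt_id t).div h1 ht).sub ((hasDerivAt_id t).const_mul 2)).add_const b
  refine h2.congr_deriv ?_
  simp only [majorantDeriv, id]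
  field_simp
  ring

theorem hasDerivAt_majorantDeriv {γ t : ℝ} (ht : 1 - γ * t ≠ 0) :
    HasDerivAt (majorantDeriv γ) (2 * γ / (1 - γ * t) ^ 3) t := by
  have h1 : HasDerivAt (fun t : ℝ => 1 - γ * t) (-γ) t := by
    simpa using ((hasDerivAt_id t).const_mul γ).const_sub 1
  have h2 := ((h1.pow 2).fun_inv (pow_ne_zero 2 ht)).sub_const 2
  refine (h2.congr_deriv ?_).congr_of_eventuallyEq (Eventually.of_forall fun s => ?_)
  · simp only [Pi.pow_apply]
    push_cast
    field_simp
  · simp [majorantDeriv]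

theorem le_of_hasDerivAt_nonneg {ψ ψ' : ℝ → ℝ} {s : ℝ} (hs0 : 0 ≤ s)
    (h : ∀ τ ∈ Icc 0 s, HasDerivAt ψ (ψ' τ) τ) (h' : ∀ τ ∈ Icc 0 s, 0 ≤ ψ' τ) : ψ 0 ≤ ψ s := by
  refine monotoneOn_of_deriv_nonneg (convex_Icc 0 s)
    (fun τ hτ => (h τ hτ).continuousAt.continuousWithinAt)
    (fun τ hτ => (h τ (interior_subset hτ)).differentiableAt.differentiableWithinAt)
    (fun τ hτ => ?_) (left_mem_Icc.2 hs0) (right_mem_Icc.2 hs0) hs0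
  rw [(h τ (interior_subset hτ)).deriv]
  exact h' τ (interior_subset hτ)

variable {X : Type*} [NormedAddCommGroup X] [NormedSpace ℝ X] {g : X → ℝ} {x₀ : X} {γ : ℝ}

/-- Along a segment the derivative of `g` grows no faster than that of the majorant. -/
theorem SmaleScalar.fderiv_line_sub_le (hg : SmaleScalar g x₀ γ) {x d : X} (v : X) {s : ℝ}
    (hs : 0 ≤ s) (hx : ‖x - x₀‖ + s * ‖d‖ < 1 / γ) :
    fderiv ℝ g (x + s • d) v - fderiv ℝ g x v ≤
      (majorantDeriv γ (‖x - x₀‖ + s * ‖d‖) - majorantDeriv γ ‖x - x₀‖) * ‖v‖ := by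
  have hγ := hg.pos
  have hnorm : ∀ τ ∈ Icc 0 s, ‖x + τ • d - x₀‖ ≤ ‖x - x₀‖ + τ * ‖d‖ := fun τ hτ => by
    rw [add_sub_right_comm]
    refine (norm_add_le _ _).trans_eq ?_
    rw [norm_smul, Real.norm_of_nonneg hτ.1]
  have hlt : ∀ τ ∈ Icc 0 s, ‖x - x₀‖ + τ * ‖d‖ < 1 / γ := fun τ hτ =>
    lt_of_le_of_lt (by gcongr; exact hτ.2) hx
  have hball : ∀ τ ∈ Icc 0 s, x + τ • d ∈ Metric.ball x₀ (1 / γ) := fun τ hτ =>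
    mem_ball_iff_norm.2 ((hnorm τ hτ).trans_lt (hlt τ hτ))
  have hpos : ∀ τ ∈ Icc 0 s, 0 < 1 - γ * (‖x - x₀‖ + τ * ‖d‖) := fun τ hτ => by
    have := hlt τ hτ
    rw [lt_div_iff₀ hγ] at this
    linarith
  have key := le_of_hasDerivAt_nonneg
    (ψ := fun τ => majorantDeriv γ (‖x - x₀‖ + τ * ‖d‖) * ‖v‖ - fderiv ℝ g (x + τ • d) v)
    (ψ' := fun τ => 2 * γ / (1 - γ * (‖x - x₀‖ + τ * ‖d‖)) ^ 3 * ‖d‖ * ‖v‖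
      - fderiv ℝ (fderiv ℝ g) (x + τ • d) d v) hs
    (fun τ hτ => by
      refine HasDerivAt.sub (HasDerivAt.mul_const ?_ _) ?_
      · have h1 : HasDerivAt (fun τ : ℝ => ‖x - x₀‖ + τ * ‖d‖) ‖d‖ τ := by
          simpa using ((hasDerivAt_id τ).mul_const ‖d‖).const_add ‖x - x₀‖
        exact (hasDerivAt_majorantDeriv (hpos τ hτ).ne').comp τ h1
      · have h1 := (hg.analytic.fderiv _ (hball τ hτ)).differentiableAt.hasFDerivAt
        have h2 := h1.comp_hasDerivAt τ (hasDerivAt_line x d τ)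
        simpa using h2.clm_apply (hasDerivAt_const τ v))
    (fun τ hτ => by
      rw [sub_nonneg]
      refine (le_abs_self _).trans ((hg.abs_fderiv_fderiv_le (hball τ hτ) d v).trans ?_)
      rw [mul_assoc]
      have := hpos τ hτ
      gcongr
      exact hnorm τ hτ)
  simp only [zero_mul, add_zero, zero_smul] at key
  linarith

theorem SmaleScalar.fderiv_sub_le (hg : SmaleScalar g x₀ γ) {z : X}
    (hz : z ∈ Metric.ball x₀ (1 / γ)) (v : X) :
    fderiv ℝ g z v - fderiv ℝ g x₀ v ≤ (majorantDeriv γ ‖z - x₀‖ + 1) * ‖v‖ := by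
  have := hg.fderiv_line_sub_le (x := x₀) (d := z - x₀) v zero_le_one
    (by simpa using mem_ball_iff_norm.1 hz)
  simp only [one_smul, add_sub_cancel, sub_self, norm_zero, zero_add, one_mul] at this
  rwa [show majorantDeriv γ 0 = -1 by norm_num [majorantDeriv], sub_neg_eq_add] at this

/-- The linearization error of `g` is dominated by that of the majorant. -/
theorem SmaleScalar.linearization_error_le (hg : SmaleScalar g x₀ γ) (b : ℝ) {x d : X}
    (hx : ‖x - x₀‖ + ‖d‖ < 1 / γ) :
    g (x + d) - g x - fderiv ℝ g x d ≤
      smaleMajorant γ b (‖x - x₀‖ + ‖d‖) - smaleMajorant γ b ‖x - x₀‖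
        - majorantDeriv γ ‖x - x₀‖ * ‖d‖ := by
  have hγ := hg.pos
  have hlt : ∀ τ ∈ Icc (0 : ℝ) 1, ‖x - x₀‖ + τ * ‖d‖ < 1 / γ := fun τ hτ =>
    lt_of_le_of_lt (by gcongr; exact mul_le_of_le_one_left (norm_nonneg _) hτ.2) hx
  have hball : ∀ τ ∈ Icc (0 : ℝ) 1, x + τ • d ∈ Metric.ball x₀ (1 / γ) := fun τ hτ => by
    refine mem_ball_iff_norm.2 (lt_of_le_of_lt ?_ (hlt τ hτ))
    rw [add_sub_right_comm]
    refine (norm_add_le _ _).trans_eq ?_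
    rw [norm_smul, Real.norm_of_nonneg hτ.1]
  have key := le_of_hasDerivAt_nonneg
    (ψ := fun τ => smaleMajorant γ b (‖x - x₀‖ + τ * ‖d‖) - τ * (majorantDeriv γ ‖x - x₀‖ * ‖d‖)
      - (g (x + τ • d) - τ * fderiv ℝ g x d))
    (ψ' := fun τ => majorantDeriv γ (‖x - x₀‖ + τ * ‖d‖) * ‖d‖ - majorantDeriv γ ‖x - x₀‖ * ‖d‖
      - (fderiv ℝ g (x + τ • d) d - fderiv ℝ g x d)) zero_le_one
    (fun τ hτ => by
      refine HasDerivAt.sub (HasDerivAt.sub ?_ ?_) (HasDerivAt.sub ?_ ?_)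
      · have h1 : HasDerivAt (fun τ : ℝ => ‖x - x₀‖ + τ * ‖d‖) ‖d‖ τ := by
          simpa using ((hasDerivAt_id τ).mul_const ‖d‖).const_add ‖x - x₀‖
        refine (hasDerivAt_smaleMajorant ?_).comp τ h1
        have := hlt τ hτ
        rw [lt_div_iff₀ hγ] at this
        linarith
      · simpa using (hasDerivAt_id τ).mul_const (majorantDeriv γ ‖x - x₀‖ * ‖d‖)
      · exact (hg.analytic _ (hball τ hτ)).differentiableAt.hasFDerivAt.comp_hasDerivAt τ
          (hasDerivAt_line x d τ)
      · simpa using (hasDerivAt_id τ).mul_const (fderiv ℝ g x d))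
    (fun τ hτ => by
      have := hg.fderiv_line_sub_le (x := x) (d := d) d hτ.1 (hlt τ hτ)
      linarith)
  simp only [zero_mul, add_zero, zero_smul, one_mul, one_smul, sub_zero] at key
  linarith

end Majorant

/-! ### The scalar majorant recursion -/

section MajorantSequence

/-- The linearization error of the majorant function at `t` in direction `δ`. -/
def linErr (γ t δ : ℝ) : ℝ := γ * δ ^ 2 / ((1 - γ * t) ^ 2 * (1 - γ * (t + δ)))

/-- The constant `b` cancels; sign and monotonicity can be read off the closed form. -/
theorem linErr_eq {γ b t δ : ℝ} (h₀ : 1 - γ * t ≠ 0) (h₁ : 1 - γ * (t + δ) ≠ 0) :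
    smaleMajorant γ b (t + δ) - smaleMajorant γ b t - majorantDeriv γ t * δ = linErr γ t δ := by
  unfold smaleMajorant majorantDeriv linErr
  obtain ⟨p, hp⟩ : ∃ p, p = 1 - γ * t := ⟨_, rfl⟩
  obtain ⟨q, hq⟩ : ∃ q, q = 1 - γ * (t + δ) := ⟨_, rfl⟩
  rw [← hp] at h₀ ⊢
  rw [← hq] at h₁ ⊢
  field_simp
  rw [hp, hq]
  ring

theorem linErr_mono {γ t δ t' δ' : ℝ} (hγ : 0 < γ) (hδ : 0 ≤ δ) (ht : t ≤ t') (hδ' : δ ≤ δ')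
    (h : γ * (t' + δ') < 1) : linErr γ t δ ≤ linErr γ t' δ' := by
  have h1 : 0 < 1 - γ * (t' + δ') := by linarith
  have h2 : 0 < 1 - γ * t' := by nlinarith
  unfold linErr
  gcongr

theorem linErr_nonneg {γ t δ : ℝ} (hγ : 0 < γ) (h : γ * (t + δ) < 1) : 0 ≤ linErr γ t δ := by
  have h1 : 0 < 1 - γ * (t + δ) := by linarith
  unfold linErr
  positivity

/-- Real constants of the inexact Newton method and the relations between them: `lam` is the
point where `t ↦ -f t / t` attains its maximum `κ`. -/
structure Constants (γ b θ lam κ : ℝ) : Prop where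
  γ_pos : 0 < γ
  b_pos : 0 < b
  θ_nonneg : 0 ≤ θ
  lam_pos : 0 < lam
  γ_lam : γ * lam < 1
  κ_pos : 0 < κ
  κ_lt : κ < 1
  deriv_lam : majorantDeriv γ lam = -κ
  apply_lam : smaleMajorant γ b lam = -κ * lam
  θ_le : 2 * θ ≤ κ * (1 + θ)

/-- With `s = √(γ b)` one has `1 - γ lam = 1 / (1 + s)`, so `f'(lam) = (1 + s)² - 2 = -κ`. Since `3
- 2√2 = (√2 - 1)²`, the bound on `b γ` says `s < √2 - 1`, that is `κ > 0`. The bound on `θ` reads `θ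
≤ κ / (2 - κ)`. -/
theorem constants_of_smale {γ b θ lam : ℝ} (hγ : 0 < γ) (hb : 0 < b)
    (hbγ : b * γ < 3 - 2 * √2) (hθ0 : 0 ≤ θ)
    (hθ : θ ≤ (1 - 2 * √(γ * b) - γ * b) / (1 + 2 * √(γ * b) + γ * b))
    (hlam : lam = b / (√(γ * b) + γ * b)) :
    Constants γ b θ lam (1 - 2 * √(γ * b) - γ * b) := by
  have hγb : 0 < γ * b := mul_pos hγ hb
  set s := √(γ * b) with hs
  have hs0 : 0 < s := Real.sqrt_pos.2 hγb
  have hss : γ * b = s ^ 2 := (Real.sq_sqrt hγb.le).symm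
  have hs1 : s < √2 - 1 := by
    have h2 : √2 ^ 2 = 2 := Real.sq_sqrt (by norm_num)
    have h3 : 1 < √2 := by
      rw [Real.lt_sqrt] <;> norm_num
    refine lt_of_pow_lt_pow_left₀ 2 (by linarith) ?_
    rw [← hss, mul_comm]
    nlinarith
  have h2 : √2 ^ 2 = 2 := Real.sq_sqrt (by norm_num)
  have hκ : 0 < 1 - 2 * s - γ * b := by
    rw [hss]
    nlinarith
  have hlam0 : 0 < lam := by rw [hlam]; positivity
  have hbl : b = lam * (s + s ^ 2) := by
    rw [hlam, hss]
    field_simp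
  have hγl : γ * lam = s / (1 + s) := by
    rw [hlam, mul_div_assoc', hss]
    field_simp
  have hp : 1 - γ * lam = 1 / (1 + s) := by
    rw [hγl]
    field_simp
    ring
  refine ⟨hγ, hb, hθ0, hlam0, ?_, hκ, by linarith, ?_, ?_, ?_⟩
  · rw [hγl, div_lt_one (by linarith)]
    linarith
  · rw [majorantDeriv, hp, hss]
    field_simp
    ring
  · rw [smaleMajorant, hp, hss]
    rw [hbl]
    field_simp
    ring
  · rw [le_div_iff₀ (by positivity)] at hθ
    linarith

variable {γ b θ lam κ : ℝ}

namespace Constants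

theorem θ_lt_one (h : Constants γ b θ lam κ) : θ < 1 := by
  have := h.θ_nonneg
  have := h.κ_lt
  have := h.θ_le
  nlinarith

theorem lt_one (h : Constants γ b θ lam κ) {t : ℝ} (ht : t ≤ lam) : γ * t < 1 :=
  (mul_le_mul_of_nonneg_left ht h.γ_pos.le).trans_lt h.γ_lam

theorem lam_lt (h : Constants γ b θ lam κ) : lam < 1 / γ := by
  rw [lt_div_iff₀ h.γ_pos, mul_comm]
  exact h.γ_lam

theorem majorantDeriv_mono (h : Constants γ b θ lam κ) {t t' : ℝ} (htt : t ≤ t') (ht : t' ≤ lam) :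
    majorantDeriv γ t ≤ majorantDeriv γ t' := by
  have := h.lt_one ht
  have := h.γ_pos
  have h1 : 0 < 1 - γ * t' := by linarith
  unfold majorantDeriv
  gcongr

theorem κ_le (h : Constants γ b θ lam κ) {t : ℝ} (ht : t ≤ lam) : κ ≤ -majorantDeriv γ t := by
  have := h.majorantDeriv_mono ht le_rfl
  rw [h.deriv_lam] at this
  linarith

theorem neg_majorantDeriv_le_one (h : Constants γ b θ lam κ) {t : ℝ} (h0 : 0 ≤ t) (ht : t ≤ lam) :
    -majorantDeriv γ t ≤ 1 := by
  have := h.majorantDeriv_mono h0 ht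
  rw [show majorantDeriv γ 0 = -1 by norm_num [majorantDeriv]] at this
  linarith

/-- Convexity: the tangent to `f` at `t` lies below `f lam = -κ lam`. -/
theorem majorant_add_le (h : Constants γ b θ lam κ) {t : ℝ} (ht : t < lam) :
    smaleMajorant γ b t + κ * t ≤ (-majorantDeriv γ t - κ) * (lam - t) := by
  have h1 := h.lt_one ht.le
  have h2 := linErr_eq (γ := γ) (b := b) (t := t) (δ := lam - t) (by linarith)
    (by rw [add_sub_cancel]; linarith [h.γ_lam])
  have h3 := linErr_nonneg (t := t) (δ := lam - t) h.γ_pos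
    (by rw [add_sub_cancel]; exact h.γ_lam)
  rw [add_sub_cancel, h.apply_lam] at h2
  linarith

/-- Since `f'` is convex, it lies below its chord over `[t, lam]`; integrating the chord gives the
factor `δ² / 2` times its slope. The computation reduces this to `2 q ≤ p + q`. -/
theorem linErr_le (h : Constants γ b θ lam κ) {t δ : ℝ} (ht : t < lam)
    (hlt : t + δ ≤ lam) :
    linErr γ t δ ≤ (-majorantDeriv γ t - κ) * δ ^ 2 / (2 * (lam - t)) := by
  have hγ := h.γ_pos
  set p := 1 - γ * t with hp
  set q := 1 - γ * lam with hq
  have hq0 : 0 < q := by linarith [h.γ_lam]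
  have hpq : q ≤ p := by
    have := mul_le_mul_of_nonneg_left ht.le hγ.le
    linarith
  have hp1 : q ≤ 1 - γ * (t + δ) := by
    have := mul_le_mul_of_nonneg_left hlt hγ.le
    linarith
  have hp0 : 0 < p := hq0.trans_le hpq
  have e1 : -majorantDeriv γ t - κ = (p - q) * (p + q) / (p ^ 2 * q ^ 2) := by
    have := h.deriv_lam
    have e : κ = -majorantDeriv γ lam := by linarith
    rw [e]
    unfold majorantDeriv
    rw [← hp, ← hq]
    field_simp
    ring
  have e2 : (lam - t) = (p - q) / γ := by
    rw [hp, hq]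
    field_simp
    ring
  have hsub : 0 < p - q := by
    have := mul_lt_mul_of_pos_left ht hγ
    linarith
  calc linErr γ t δ ≤ γ * δ ^ 2 / (p ^ 2 * q) := by
        unfold linErr
        gcongr
    _ = γ * δ ^ 2 * (2 * q) / (2 * (p ^ 2 * q ^ 2)) := by field_simp
    _ ≤ γ * δ ^ 2 * (p + q) / (2 * (p ^ 2 * q ^ 2)) := by
        gcongr
        linarith
    _ = (-majorantDeriv γ t - κ) * δ ^ 2 / (2 * (lam - t)) := by
        rw [e1, e2]
        field_simp

end Constants

/-- The increment of the majorant sequence at `(t, ε)`. -/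
def majStep (γ b θ t ε : ℝ) : ℝ := (1 + θ) * (smaleMajorant γ b t + ε) / (-majorantDeriv γ t)

/-- The majorant sequence of pairs `(t, ε)`. -/
def majSeq (γ b θ : ℝ) : ℕ → ℝ × ℝ
  | 0 => (0, 0)
  | k + 1 =>
    let p := majSeq γ b θ k
    (p.1 + majStep γ b θ p.1 p.2, p.2 + 2 * θ * (smaleMajorant γ b p.1 + p.2))

/-- One step of the majorant recursion keeps `(t, ε)` in the admissible region and decreases the
bound on the residual. -/
theorem Constants.majStep_spec (h : Constants γ b θ lam κ) {t ε : ℝ} (h0 : 0 ≤ t) (ht : t < lam)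
    (hε : ε ≤ κ * t) (he : 0 ≤ smaleMajorant γ b t + ε) :
    0 ≤ majStep γ b θ t ε ∧ t + majStep γ b θ t ε < lam ∧
    ε + 2 * θ * (smaleMajorant γ b t + ε) ≤ κ * (t + majStep γ b θ t ε) ∧
    smaleMajorant γ b (t + majStep γ b θ t ε) + (ε + 2 * θ * (smaleMajorant γ b t + ε)) =
      θ * (smaleMajorant γ b t + ε) + linErr γ t (majStep γ b θ t ε) ∧
    θ * (smaleMajorant γ b t + ε) + linErr γ t (majStep γ b θ t ε) ≤
      (1 + θ ^ 2) / 2 * (smaleMajorant γ b t + ε) := by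
  have hθ := h.θ_nonneg
  have hθ1 := h.θ_lt_one
  have hκ := h.κ_pos
  have hm := h.κ_le ht.le
  have hm1 := h.neg_majorantDeriv_le_one h0 ht.le
  have hadd := h.majorant_add_le ht
  have hθκ := h.θ_le
  set m := -majorantDeriv γ t with hmdef
  set e := smaleMajorant γ b t + ε with hedef
  set Δ := majStep γ b θ t ε with hΔdef
  have hm0 : 0 < m := hκ.trans_le hm
  have hΔ : Δ = (1 + θ) * e / m := rfl
  have hΔm : Δ * m = (1 + θ) * e := by rw [hΔ]; field_simp
  have hΔ0 : 0 ≤ Δ := by rw [hΔ]; positivity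
  have hele : e ≤ (m - κ) * (lam - t) := by linarith
  -- Equivalent to `2 θ m ≤ κ (1 + θ)`, which holds because `m ≤ 1`; this is where the upper bound
  -- on `θ` is spent.
  have hθm : (1 + θ) * (m - κ) ≤ (1 - θ) * m := by nlinarith
  have hlt : t + Δ < lam := by
    have h1 : Δ * m ≤ (1 + θ) * (m - κ) * (lam - t) := by
      rw [hΔm, mul_assoc]
      exact mul_le_mul_of_nonneg_left hele (by linarith)
    have h2 : (1 + θ) * (m - κ) < m := by
      have : 0 < (1 + θ) * κ := by positivity
      nlinarith
    have h3 := mul_lt_mul_of_pos_right h2 (sub_pos.2 ht)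
    have h4 : Δ * m < (lam - t) * m := by linarith
    linarith [lt_of_mul_lt_mul_right h4 hm0.le]
  refine ⟨hΔ0, hlt, ?_, ?_, ?_⟩
  · have h1 : 2 * θ * e ≤ κ * ((1 + θ) * e) := by
      rw [← mul_assoc]
      exact mul_le_mul_of_nonneg_right hθκ he
    have h2 : Δ * m ≤ Δ := mul_le_of_le_one_right hΔ0 hm1
    rw [hΔm] at h2
    have h3 := mul_le_mul_of_nonneg_left h2 hκ.le
    linarith
  -- The step overshoots the Newton step of `f + ε` by the factor `1 + θ`, leaving `-θ e` plus the
  -- linearization error; the increment `2 θ e` of `ε` turns this into `θ e`, matching the true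
  -- residual estimate.
  · have h1 := linErr_eq (γ := γ) (b := b) (t := t) (δ := Δ)
      (by linarith [h.lt_one ht.le]) (by linarith [h.lt_one hlt.le])
    have h2 : majorantDeriv γ t * Δ = -((1 + θ) * e) := by
      rw [← hΔm, hmdef]
      ring
    rw [h2] at h1
    linarith
  · have h1 := h.linErr_le ht hlt.le
    rw [← hmdef] at h1
    have hlt' : 0 < lam - t := sub_pos.2 ht
    -- This suffices, as `θ + (1 - θ)² / 2 = (1 + θ²) / 2`.
    have h2 : (m - κ) * Δ ^ 2 / (2 * (lam - t)) ≤ (1 - θ) ^ 2 / 2 * e := by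
      have hmκ : 0 ≤ m - κ := by linarith
      have e1 : (m - κ) * Δ ^ 2 / (2 * (lam - t)) =
          (m - κ) * (1 + θ) ^ 2 * e / (2 * (lam - t) * m ^ 2) * e := by
        rw [hΔ]
        field_simp
      rw [e1]
      refine mul_le_mul_of_nonneg_right ?_ he
      rw [div_le_div_iff₀ (by positivity) two_pos]
      have h3 : (m - κ) * (1 + θ) ^ 2 * e ≤ (m - κ) * (1 + θ) ^ 2 * ((m - κ) * (lam - t)) :=
        mul_le_mul_of_nonneg_left hele (by positivity)
      have h4 : ((1 + θ) * (m - κ)) ^ 2 ≤ ((1 - θ) * m) ^ 2 :=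
        pow_le_pow_left₀ (by positivity) hθm 2
      have h5 := mul_le_mul_of_nonneg_right h4 hlt'.le
      nlinarith
    nlinarith

theorem Constants.majSeq_spec (h : Constants γ b θ lam κ) (k : ℕ) :
    0 ≤ (majSeq γ b θ k).1 ∧ (majSeq γ b θ k).1 < lam ∧
    (majSeq γ b θ k).2 ≤ κ * (majSeq γ b θ k).1 ∧
    0 ≤ smaleMajorant γ b (majSeq γ b θ k).1 + (majSeq γ b θ k).2 ∧
    smaleMajorant γ b (majSeq γ b θ k).1 + (majSeq γ b θ k).2 ≤ ((1 + θ ^ 2) / 2) ^ k * b := by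
  induction k with
  | zero =>
    have : smaleMajorant γ b 0 = b := by simp [smaleMajorant]
    simp [majSeq, this, h.lam_pos, h.b_pos.le]
  | succ k ih =>
    obtain ⟨h0, ht, hε, he, hle⟩ := ih
    obtain ⟨i1, i2, i3, i4, i5⟩ := h.majStep_spec h0 ht hε he
    simp only [majSeq]
    refine ⟨by linarith, i2, i3, ?_, ?_⟩
    · rw [i4]
      exact add_nonneg (mul_nonneg h.θ_nonneg he) (linErr_nonneg h.γ_pos (h.lt_one i2.le))
    · rw [i4, pow_succ', mul_assoc]
      exact i5.trans (mul_le_mul_of_nonneg_left hle (by positivity))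

end MajorantSequence

/-! ### Estimates for a single inexact Newton step -/

section Setting

variable {X Y : Type*} [NormedAddCommGroup X] [NormedSpace ℝ X]
  [NormedAddCommGroup Y] [NormedSpace ℝ Y]

/-- The real value of `‖T_{x₀}⁻¹ y‖`. -/
abbrev invNorm (F : X → Y) (C : ConvexCone ℝ Y) (x₀ : X) (y : Y) : ℝ :=
  procNorm (fderiv ℝ F x₀) C y

/-- Standing assumptions of the convergence analysis, with the Smale condition expressed through
the linear functionals dominated by `‖T_{x₀}⁻¹ ·‖`. -/
structure NewtonSetting (F : X → Y) (C : ConvexCone ℝ Y) (x₀ : X) (γ b θ lam κ : ℝ) : Prop where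
  consts : Constants γ b θ lam κ
  regular : RegularProcess (fderiv ℝ F x₀) C
  analytic : AnalyticOnNhd ℝ F (Metric.ball x₀ (1 / γ))
  scalar : ∀ φ : StrongDual ℝ Y, (∀ z, φ z ≤ invNorm F C x₀ z) →
    SmaleScalar (fun x => φ (F x)) x₀ γ

theorem SmaleScalar.neg {g : X → ℝ} {x₀ : X} {γ : ℝ} (hg : SmaleScalar g x₀ γ) :
    SmaleScalar (fun x => -g x) x₀ γ where
  pos := hg.pos
  analytic := hg.analytic.neg
  bound n hn v hv := by
    change |iteratedFDeriv ℝ n (-g) x₀ v| ≤ _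
    rw [iteratedFDeriv_neg, Pi.neg_apply, neg_apply, abs_neg]
    exact hg.bound n hn v hv

theorem setNorm_Tinv {F : X → Y} {C : ConvexCone ℝ Y} {x₀ : X}
    (h : RegularProcess (fderiv ℝ F x₀) C) (y : Y) :
    setNorm (Tinv F C x₀ y) = ENNReal.ofReal (invNorm F C x₀ y) := by
  refine le_antisymm ?_ ?_
  · obtain ⟨d, hd, hdn⟩ := h.exists_norm_eq y
    rw [invNorm, ← hdn, ofReal_norm]
    exact iInf₂_le d hd
  · refine le_iInf₂ fun d hd => ?_
    rw [← ofReal_norm]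
    exact ENNReal.ofReal_le_ofReal (procNorm_le hd)

theorem isResidual_iff {F : X → Y} {C : ConvexCone ℝ Y} {x₀ x : X} {θ : ℝ} (hθ : 0 ≤ θ) {r : Y}
    (h : RegularProcess (fderiv ℝ F x₀) C) :
    IsResidual F C x₀ θ x r ↔ invNorm F C x₀ (-r) ≤ θ * invNorm F C x₀ (-F x) ∧
      invNorm F C x₀ r ≤ θ * invNorm F C x₀ (-F x) := by
  rw [IsResidual, setNorm_Tinv h, setNorm_Tinv h, setNorm_Tinv h, ← ENNReal.ofReal_mul hθ,
    max_le_iff, ENNReal.ofReal_le_ofReal_iff (mul_nonneg hθ (procNorm_nonneg _ _ _)),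
    ENNReal.ofReal_le_ofReal_iff (mul_nonneg hθ (procNorm_nonneg _ _ _))]

namespace NewtonSetting

variable {F : X → Y} {C : ConvexCone ℝ Y} {x₀ : X} {γ b θ lam κ : ℝ}

theorem mem_ball_of_le (h : NewtonSetting F C x₀ γ b θ lam κ) {z : X} (hz : ‖z - x₀‖ ≤ lam) :
    z ∈ Metric.ball x₀ (1 / γ) :=
  mem_ball_iff_norm.2 (hz.trans_lt h.consts.lam_lt)

theorem hasFDerivAt (h : NewtonSetting F C x₀ γ b θ lam κ) {z : X}
    (hz : z ∈ Metric.ball x₀ (1 / γ)) : HasFDerivAt F (fderiv ℝ F z) z :=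
  (h.analytic z hz).differentiableAt.hasFDerivAt

/-- The iterates are controlled by the majorant sequence. -/
def Controlled (F : X → Y) (C : ConvexCone ℝ Y) (x₀ : X) (γ b θ : ℝ) (k : ℕ) (x : X) : Prop :=
  ‖x - x₀‖ ≤ (majSeq γ b θ k).1 ∧
    invNorm F C x₀ (-F x) ≤ smaleMajorant γ b (majSeq γ b θ k).1 + (majSeq γ b θ k).2

theorem Controlled.norm_lt (h : NewtonSetting F C x₀ γ b θ lam κ) {k : ℕ} {x : X}
    (hx : Controlled F C x₀ γ b θ k x) : ‖x - x₀‖ < lam :=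
  hx.1.trans_lt (h.consts.majSeq_spec k).2.1

variable [CompleteSpace Y]

theorem invNorm_fderiv_sub_le (h : NewtonSetting F C x₀ γ b θ lam κ) {z : X}
    (hz : z ∈ Metric.ball x₀ (1 / γ)) (v : X) :
    invNorm F C x₀ ((fderiv ℝ F z - fderiv ℝ F x₀) v) ≤
      (majorantDeriv γ ‖z - x₀‖ + 1) * ‖v‖ := by
  obtain ⟨φ, hφ, hφe⟩ := h.regular.exists_dual_eq ((fderiv ℝ F z - fderiv ℝ F x₀) v)
  have hx₀ : x₀ ∈ Metric.ball x₀ (1 / γ) :=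
    Metric.mem_ball_self (one_div_pos.2 h.consts.γ_pos)
  have h1 := (h.scalar φ hφ).fderiv_sub_le hz v
  have h2 : fderiv ℝ (fun x => φ (F x)) z = φ.comp (fderiv ℝ F z) :=
    (φ.hasFDerivAt.comp z (h.hasFDerivAt hz)).fderiv
  have h3 : fderiv ℝ (fun x => φ (F x)) x₀ = φ.comp (fderiv ℝ F x₀) :=
    (φ.hasFDerivAt.comp x₀ (h.hasFDerivAt hx₀)).fderiv
  rw [h2, h3] at h1
  rw [invNorm, ← hφe]
  simpa using h1

theorem invNorm_linearization_le (h : NewtonSetting F C x₀ γ b θ lam κ) {x d : X}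
    (hx : ‖x - x₀‖ + ‖d‖ < 1 / γ) :
    invNorm F C x₀ (-(F (x + d) - F x - fderiv ℝ F x d)) ≤ linErr γ ‖x - x₀‖ ‖d‖ := by
  have hγ := h.consts.γ_pos
  obtain ⟨φ, hφ, hφe⟩ :=
    h.regular.exists_dual_eq (-(F (x + d) - F x - fderiv ℝ F x d))
  have hx' : ‖x - x₀‖ < 1 / γ := lt_of_le_of_lt (by linarith [norm_nonneg d]) hx
  -- The least norm is one-sided and the error enters with a minus sign, so the scalar estimate is
  -- applied to `-φ ∘ F`.
  have h1 := (h.scalar φ hφ).neg.linearization_error_le b hx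
  have h2 : fderiv ℝ (fun x => -φ (F x)) x = -φ.comp (fderiv ℝ F x) :=
    (φ.hasFDerivAt.comp x (h.hasFDerivAt (mem_ball_iff_norm.2 hx'))).neg.fderiv
  rw [lt_div_iff₀ hγ] at hx hx'
  rw [h2, linErr_eq (by linarith) (by linarith)] at h1
  rw [invNorm, ← hφe]
  refine le_trans (le_of_eq ?_) h1
  simp
  ring

theorem invNorm_fderiv_le (h : NewtonSetting F C x₀ γ b θ lam κ) {z : X} (hz : ‖z - x₀‖ ≤ lam)
    (v : X) : invNorm F C x₀ (fderiv ℝ F z v) ≤ (2 - κ) * ‖v‖ := by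
  have h1 := h.invNorm_fderiv_sub_le (h.mem_ball_of_le hz) v
  have h2 := h.regular.procNorm_map_le v
  have h3 := h.regular.procNorm_add (fderiv ℝ F x₀ v) ((fderiv ℝ F z - fderiv ℝ F x₀) v)
  have h4 := mul_le_mul_of_nonneg_right (h.consts.κ_le hz) (norm_nonneg v)
  rw [show fderiv ℝ F x₀ v + (fderiv ℝ F z - fderiv ℝ F x₀) v = fderiv ℝ F z v by simp] at h3
  simp only [invNorm] at *
  linarith

/-- Mean value inequality for a norming functional `φ`: as `F z ∈ C`, `φ (-F z) ≤ 0`, so only the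
variation of `φ ∘ F` between `x` and `z` counts. It bounds the residual by the distance to the
limit. -/
theorem invNorm_neg_apply_le (h : NewtonSetting F C x₀ γ b θ lam κ) {x z : X}
    (hx : ‖x - x₀‖ ≤ lam) (hz : ‖z - x₀‖ ≤ lam) (hFz : F z ∈ C) :
    invNorm F C x₀ (-F x) ≤ (2 - κ) * ‖z - x‖ := by
  obtain ⟨φ, hφ, hφe⟩ := h.regular.exists_dual_eq (-F x)
  have hseg : ∀ τ ∈ Icc (0 : ℝ) 1, ‖x + τ • (z - x) - x₀‖ ≤ lam := fun τ hτ => by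
    have := (convex_closedBall x₀ lam).add_smul_sub_mem
      (mem_closedBall_iff_norm.2 hx) (mem_closedBall_iff_norm.2 hz) hτ
    exact mem_closedBall_iff_norm.1 this
  have key := le_of_hasDerivAt_nonneg
    (ψ := fun τ => τ * ((2 - κ) * ‖z - x‖) - φ (F (x + τ • (z - x))))
    (ψ' := fun τ => (2 - κ) * ‖z - x‖ - φ (fderiv ℝ F (x + τ • (z - x)) (z - x))) zero_le_one
    (fun τ hτ => by
      refine HasDerivAt.sub ?_ ?_
      · simpa using (hasDerivAt_id τ).mul_const ((2 - κ) * ‖z - x‖)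
      · exact φ.hasFDerivAt.comp_hasDerivAt τ
          ((h.hasFDerivAt (h.mem_ball_of_le (hseg τ hτ))).comp_hasDerivAt τ
            (hasDerivAt_line x (z - x) τ)))
    (fun τ hτ => sub_nonneg.2 ((hφ _).trans (h.invNorm_fderiv_le (hseg τ hτ) _)))
  simp only [zero_mul, zero_smul, add_zero, one_mul, one_smul, add_sub_cancel] at key
  have h1 := hφ (-F z)
  rw [procNorm_neg_of_mem hFz, map_neg] at h1
  rw [map_neg] at hφe
  rw [invNorm]
  linarith

/-- Split `-F (x + d)` into an element of `-C`, which costs nothing, the residual `r`, and minus the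
linearization error. -/
theorem invNorm_next_le (h : NewtonSetting F C x₀ γ b θ lam κ) {x d : X} {r : Y}
    (hx : ‖x - x₀‖ + ‖d‖ < 1 / γ) (hr : IsResidual F C x₀ θ x r) (hd : IsStep F C x r d) :
    invNorm F C x₀ (-F (x + d)) ≤
      θ * invNorm F C x₀ (-F x) + linErr γ ‖x - x₀‖ ‖d‖ := by
  have h1 := h.invNorm_linearization_le hx
  have h2 := ((isResidual_iff h.consts.θ_nonneg h.regular).1 hr).2
  have h3 := procNorm_neg_of_mem (A := fderiv ℝ F x₀) hd.1
  have h4 := h.regular.procNorm_add (-(F x + fderiv ℝ F x d + r)) r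
  have h5 := h.regular.procNorm_add (-(F x + fderiv ℝ F x d + r) + r)
    (-(F (x + d) - F x - fderiv ℝ F x d))
  rw [show -(F x + fderiv ℝ F x d + r) + r + -(F (x + d) - F x - fderiv ℝ F x d) = -F (x + d) by
    abel] at h5
  simp only [invNorm] at *
  linarith

theorem invNorm_le_step (h : NewtonSetting F C x₀ γ b θ lam κ) {x d : X} {r : Y}
    (hx : ‖x - x₀‖ ≤ lam) (hr : IsResidual F C x₀ θ x r) (hd : IsStep F C x r d) :
    (1 - θ) * invNorm F C x₀ (-F x) ≤ (2 - κ) * ‖d‖ := by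
  have h1 := h.invNorm_fderiv_le hx d
  have h2 := ((isResidual_iff h.consts.θ_nonneg h.regular).1 hr).2
  have h3 := procNorm_neg_of_mem (A := fderiv ℝ F x₀) hd.1
  have h4 := h.regular.procNorm_add (-(F x + fderiv ℝ F x d + r)) r
  have h5 := h.regular.procNorm_add (-(F x + fderiv ℝ F x d + r) + r) (fderiv ℝ F x d)
  rw [show -(F x + fderiv ℝ F x d + r) + r + fderiv ℝ F x d = -F x by abel] at h5
  simp only [invNorm] at *
  linarith

variable [CompleteSpace X]

/-- Perturbation of `F'(x₀)` by `F'(z) - F'(x₀)`, whose relative size is `M = f'(‖z - x₀‖) + 1 < 1`,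
so that `1 - M = -f'(‖z - x₀‖)`. -/
theorem exists_mem_le (h : NewtonSetting F C x₀ γ b θ lam κ) {z : X} (hz : ‖z - x₀‖ ≤ lam)
    (y : Y) : ∃ d, fderiv ℝ F z d - y ∈ C ∧
      ‖d‖ ≤ invNorm F C x₀ y / -majorantDeriv γ ‖z - x₀‖ := by
  have h1 := h.consts.neg_majorantDeriv_le_one (norm_nonneg _) hz
  have h2 := h.consts.κ_le hz
  have h3 := h.consts.κ_pos
  obtain ⟨d, hd, hdn⟩ := h.regular.exists_perturb (B := fderiv ℝ F z - fderiv ℝ F x₀)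
    (M := majorantDeriv γ ‖z - x₀‖ + 1) (by linarith) (by linarith)
    (h.invNorm_fderiv_sub_le (h.mem_ball_of_le hz)) y
  rw [add_sub_cancel] at hd
  refine ⟨d, hd, hdn.trans_eq ?_⟩
  congr 1
  ring

theorem exists_isStep (h : NewtonSetting F C x₀ γ b θ lam κ) {x : X} (hx : ‖x - x₀‖ ≤ lam)
    (r : Y) : ∃ d, IsStep F C x r d := by
  have e : ∀ d, F x + fderiv ℝ F x d + r = fderiv ℝ F x d - (-F x - r) := fun d => by abel
  obtain ⟨d₁, hd₁, -⟩ := h.exists_mem_le hx (-F x - r)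
  obtain ⟨d, hd, hmin⟩ := exists_forall_norm_le_of_reflexive h.regular.reflexive ⟨d₁, hd₁⟩
    (convex_preimage_sub (fderiv ℝ F x) C.convex (-F x - r))
    (isClosed_preimage_sub (fderiv ℝ F x) h.regular.closed (-F x - r))
  exact ⟨d, by rw [e]; exact hd, fun d' hd' => hmin d' (by rw [e] at hd'; exact hd')⟩

/-- The bound on `-r` is used here, whereas the next residual needs the bound on `r`. The free `t`
allows both the majorant point and `lam`. -/
theorem norm_step_le (h : NewtonSetting F C x₀ γ b θ lam κ) {x d : X} {r : Y} {t : ℝ}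
    (hxt : ‖x - x₀‖ ≤ t) (ht : t ≤ lam) (hr : IsResidual F C x₀ θ x r) (hd : IsStep F C x r d) :
    ‖d‖ ≤ (1 + θ) * invNorm F C x₀ (-F x) / -majorantDeriv γ t := by
  obtain ⟨d', hd', hdn⟩ := h.exists_mem_le (hxt.trans ht) (-F x - r)
  have hκ := h.consts.κ_pos.trans_le (h.consts.κ_le ht)
  have hr1 := ((isResidual_iff h.consts.θ_nonneg h.regular).1 hr).1
  have h1 := h.regular.procNorm_add (-F x) (-r)
  refine (hd.2 d' ?_).trans (hdn.trans ?_)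
  · rwa [show F x + fderiv ℝ F x d' + r = fderiv ℝ F x d' - (-F x - r) by abel]
  · have h0 : 0 ≤ invNorm F C x₀ (-F x - r) := procNorm_nonneg _ _ _
    have h2 := h.consts.majorantDeriv_mono hxt ht
    have h3 : invNorm F C x₀ (-F x - r) ≤ (1 + θ) * invNorm F C x₀ (-F x) := by
      rw [sub_eq_add_neg, invNorm] at *
      linarith
    exact div_le_div₀ (h0.trans h3) h3 hκ (by linarith)

theorem controlled_succ (h : NewtonSetting F C x₀ γ b θ lam κ) {k : ℕ} {x x' : X}
    (hx : Controlled F C x₀ γ b θ k x) (hit : IsIteration F C x₀ θ x x') :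
    Controlled F C x₀ γ b θ (k + 1) x' ∧
      ‖x - x'‖ ≤ (majSeq γ b θ (k + 1)).1 - (majSeq γ b θ k).1 := by
  obtain ⟨r, d, hr, hd, rfl⟩ := hit
  obtain ⟨h0, ht, hε, he, -⟩ := h.consts.majSeq_spec k
  obtain ⟨i1, i2, i3, i4, -⟩ := h.consts.majStep_spec h0 ht hε he
  obtain ⟨hx1, hx2⟩ := hx
  have hθ := h.consts.θ_nonneg
  have hm := h.consts.κ_pos.trans_le (h.consts.κ_le ht.le)
  have hdn : ‖d‖ ≤ majStep γ b θ (majSeq γ b θ k).1 (majSeq γ b θ k).2 := by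
    refine (h.norm_step_le hx1 ht.le hr hd).trans ?_
    unfold majStep
    gcongr
  refine ⟨⟨?_, ?_⟩, ?_⟩
  · simp only [majSeq]
    rw [add_sub_right_comm]
    exact (norm_add_le _ _).trans (add_le_add hx1 hdn)
  · simp only [majSeq]
    rw [i4]
    refine (h.invNorm_next_le ?_ hr hd).trans ?_
    · exact (add_le_add hx1 hdn).trans_lt (i2.trans h.consts.lam_lt)
    · gcongr
      exact linErr_mono h.consts.γ_pos (norm_nonneg _) hx1 hdn (h.consts.lt_one i2.le)
  · simp only [majSeq]
    simpa using hdn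

/-- Finite prefixes suffice, so this also applies before any infinite sequence is known to exist. -/
theorem controlled_of_prefix (h : NewtonSetting F C x₀ γ b θ lam κ)
    (hb : invNorm F C x₀ (-F x₀) ≤ b) {n : ℕ} {x : ℕ → X} (hx0 : x 0 = x₀)
    (hit : ∀ k < n, IsIteration F C x₀ θ (x k) (x (k + 1))) :
    ∀ k ≤ n, Controlled F C x₀ γ b θ k (x k) := by
  intro k
  induction k with
  | zero =>
    intro _
    rw [hx0]
    simpa [Controlled, majSeq, smaleMajorant] using hb
  | succ k ih => exact fun hk => (h.controlled_succ (ih (by omega)) (hit k (by omega))).1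

end NewtonSetting

end Setting

/-! ### Convergence of the iterates and linear rate -/

section Convergence

variable {X Y : Type*} [NormedAddCommGroup X] [NormedSpace ℝ X]
  [NormedAddCommGroup Y] [NormedSpace ℝ Y]

theorem processNorm_le_of_smale {F : X → Y} {Ω : Set X} {C : ConvexCone ℝ Y} {x₀ : X} {γ : ℝ}
    (h : Smale F Ω C x₀ γ) {n : ℕ} (hn : 1 < n) :
    processNorm (fun v : Fin n → X => Tinv F C x₀ (iteratedFDeriv ℝ n F x₀ v)) ≤
      ENNReal.ofReal (n.factorial * γ ^ (n - 1)) := by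
  have hfac : (n.factorial : ℝ≥0∞) ≠ 0 := by exact_mod_cast n.factorial_ne_zero
  have h1 : (processNorm (fun v : Fin n → X => Tinv F C x₀ (iteratedFDeriv ℝ n F x₀ v))
      / (n.factorial : ℝ≥0∞)) ^ (1 / ((n : ℝ) - 1)) ≤ ENNReal.ofReal γ := by
    rw [← h.sup_eq]
    exact le_iSup₂ (f := fun (n : ℕ) (_ : 1 < n) =>
      (processNorm (fun v : Fin n → X => Tinv F C x₀ (iteratedFDeriv ℝ n F x₀ v))
        / (n.factorial : ℝ≥0∞)) ^ (1 / ((n : ℝ) - 1))) n hn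
  have hn' : (1 : ℝ) < n := by exact_mod_cast hn
  rw [one_div, ENNReal.rpow_inv_le_iff (by linarith),
    ENNReal.div_le_iff hfac (ENNReal.natCast_ne_top _)] at h1
  refine h1.trans_eq ?_
  have e : (n : ℝ) - 1 = ((n - 1 : ℕ) : ℝ) := by
    rw [Nat.cast_sub hn.le, Nat.cast_one]
  rw [e, ENNReal.rpow_natCast, mul_comm, ENNReal.ofReal_mul (by positivity),
    ENNReal.ofReal_natCast, ENNReal.ofReal_pow h.pos.le]

theorem smaleScalar_of_smale [CompleteSpace Y] {F : X → Y} {Ω : Set X} {C : ConvexCone ℝ Y} {x₀ : X}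
    {γ : ℝ} (h : Smale F Ω C x₀ γ) (hreg : RegularProcess (fderiv ℝ F x₀) C) (φ : StrongDual ℝ Y)
    (hφ : ∀ z, φ z ≤ invNorm F C x₀ z) : SmaleScalar (fun x => φ (F x)) x₀ γ where
  pos := h.pos
  analytic := φ.comp_analyticOnNhd
    (h.analyticOn.mono (interior_maximal h.ball_subset Metric.isOpen_ball))
  bound := by
    intro n hn v hv
    have han : AnalyticAt ℝ F x₀ := h.analyticOn x₀
      (interior_maximal h.ball_subset Metric.isOpen_ball
        (Metric.mem_ball_self (one_div_pos.2 h.pos)))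
    have e : iteratedFDeriv ℝ n (fun x => φ (F x)) x₀ =
        φ.compContinuousMultilinearMap (iteratedFDeriv ℝ n F x₀) :=
      φ.iteratedFDeriv_comp_left (n := n) han.contDiffAt le_rfl
    have hone : ∀ v : Fin n → X, (∀ i, ‖v i‖ ≤ 1) →
        φ (iteratedFDeriv ℝ n F x₀ v) ≤ n.factorial * γ ^ (n - 1) := fun v hv => by
      have hγ := h.pos
      refine (hφ _).trans ?_
      rw [← ENNReal.ofReal_le_ofReal_iff (by positivity), ← setNorm_Tinv hreg]
      refine le_trans ?_ (processNorm_le_of_smale h hn)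
      refine le_iSup_of_le v (le_iSup_of_le (hreg.surj _) (le_iSup_of_le ?_ le_rfl))
      exact (pi_norm_le_iff_of_nonneg zero_le_one).2 hv
    obtain ⟨m, rfl⟩ : ∃ m, n = m + 1 := ⟨n - 1, by omega⟩
    rw [e, ContinuousLinearMap.compContinuousMultilinearMap_coe, Function.comp_apply, abs_le']
    refine ⟨hone v hv, ?_⟩
    -- Only upper bounds are available for `φ`; the lower bound follows by flipping the sign of one
    -- argument.
    have hneg : -iteratedFDeriv ℝ (m + 1) F x₀ v =
        iteratedFDeriv ℝ (m + 1) F x₀ (Function.update v 0 ((-1 : ℝ) • v 0)) := by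
      rw [ContinuousMultilinearMap.map_update_smul, Function.update_eq_self, neg_one_smul]
    rw [← map_neg, hneg]
    refine hone _ fun i => ?_
    rcases eq_or_ne i 0 with rfl | hi
    · simpa using hv 0
    · simpa [Function.update_of_ne hi] using hv i

namespace NewtonSetting

variable {F : X → Y} {C : ConvexCone ℝ Y} {x₀ : X} {γ b θ lam κ : ℝ}

theorem isResidual_zero (h : NewtonSetting F C x₀ γ b θ lam κ) (x : X) :
    IsResidual F C x₀ θ x 0 := by
  rw [isResidual_iff h.consts.θ_nonneg h.regular]
  have := mul_nonneg h.consts.θ_nonneg (procNorm_nonneg (fderiv ℝ F x₀) C (-F x))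
  simpa [invNorm, h.regular.procNorm_zero] using this

variable [CompleteSpace X] [CompleteSpace Y]

theorem exists_isNewtonSeq (h : NewtonSetting F C x₀ γ b θ lam κ)
    (hb : invNorm F C x₀ (-F x₀) ≤ b) : ∃ x : ℕ → X, IsNewtonSeq F C x₀ θ x := by
  have hstep : ∀ x : X, ∃ x', ‖x - x₀‖ ≤ lam → IsIteration F C x₀ θ x x' := fun x => by
    by_cases hx : ‖x - x₀‖ ≤ lam
    · obtain ⟨d, hd⟩ := h.exists_isStep hx 0
      exact ⟨x + d, fun _ => ⟨0, d, h.isResidual_zero x, hd, rfl⟩⟩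
    · exact ⟨x, fun hx' => absurd hx' hx⟩
  choose next hnext using hstep
  let x : ℕ → X := fun n => Nat.rec x₀ (fun _ z => next z) n
  have hall : ∀ n, ∀ k < n, IsIteration F C x₀ θ (x k) (x (k + 1)) := by
    intro n
    induction n with
    | zero => intro k hk; omega
    | succ n ih =>
      intro k hk
      have hc := h.controlled_of_prefix hb (x := x) rfl ih k (by omega)
      exact hnext _ (Controlled.norm_lt h hc).le
  exact ⟨x, rfl, fun k => hall (k + 1) k (by omega)⟩

theorem controlled (h : NewtonSetting F C x₀ γ b θ lam κ) (hb : invNorm F C x₀ (-F x₀) ≤ b)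
    {x : ℕ → X} (hx : IsNewtonSeq F C x₀ θ x) (k : ℕ) : Controlled F C x₀ γ b θ k (x k) :=
  h.controlled_of_prefix hb hx.1 (fun k _ => hx.2 k) k le_rfl

theorem invNorm_le_pow (h : NewtonSetting F C x₀ γ b θ lam κ)
    (hb : invNorm F C x₀ (-F x₀) ≤ b) {x : ℕ → X} (hx : IsNewtonSeq F C x₀ θ x) (k : ℕ) :
    invNorm F C x₀ (-F (x k)) ≤ ((1 + θ ^ 2) / 2) ^ k * b :=
  (h.controlled hb hx k).2.trans (h.consts.majSeq_spec k).2.2.2.2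

/-- The residual at the next iterate in terms of the current residual and step. -/
theorem invNorm_succ_le (h : NewtonSetting F C x₀ γ b θ lam κ)
    (hb : invNorm F C x₀ (-F x₀) ≤ b) {x : ℕ → X} (hx : IsNewtonSeq F C x₀ θ x) (k : ℕ) :
    invNorm F C x₀ (-F (x (k + 1))) ≤ θ * invNorm F C x₀ (-F (x k)) +
      γ / (1 - γ * lam) ^ 3 * ‖x k - x (k + 1)‖ ^ 2 := by
  have hc := h.controlled hb hx k
  have hs := (h.controlled_succ hc (hx.2 k)).2
  obtain ⟨r, d, hr, hd, hxd⟩ := hx.2 k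
  have hdn : ‖x k - x (k + 1)‖ = ‖d‖ := by rw [hxd]; simp
  rw [hdn] at hs ⊢
  have hlt := (h.consts.majSeq_spec (k + 1)).2.1
  have hsum : ‖x k - x₀‖ + ‖d‖ ≤ lam := by linarith [hc.1]
  rw [hxd]
  refine (h.invNorm_next_le (hsum.trans_lt h.consts.lam_lt) hr hd).trans ?_
  gcongr
  have hγ := h.consts.γ_pos
  have h1 : 0 < 1 - γ * lam := by linarith [h.consts.γ_lam]
  have h2 : γ * (‖x k - x₀‖ + ‖d‖) ≤ γ * lam := mul_le_mul_of_nonneg_left hsum hγ.le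
  have h3 : γ * ‖x k - x₀‖ ≤ γ * lam := by nlinarith [norm_nonneg d]
  calc linErr γ ‖x k - x₀‖ ‖d‖ ≤ γ * ‖d‖ ^ 2 / ((1 - γ * lam) ^ 2 * (1 - γ * lam)) := by
        unfold linErr
        gcongr
    _ = γ / (1 - γ * lam) ^ 3 * ‖d‖ ^ 2 := by field_simp

theorem norm_sub_le_invNorm (h : NewtonSetting F C x₀ γ b θ lam κ)
    (hb : invNorm F C x₀ (-F x₀) ≤ b) {x : ℕ → X} (hx : IsNewtonSeq F C x₀ θ x) (k : ℕ) :
    ‖x k - x (k + 1)‖ ≤ (1 + θ) / κ * invNorm F C x₀ (-F (x k)) := by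
  have hc := (Controlled.norm_lt h (h.controlled hb hx k)).le
  obtain ⟨r, d, hr, hd, hxd⟩ := hx.2 k
  have hdn : ‖x k - x (k + 1)‖ = ‖d‖ := by rw [hxd]; simp
  rw [hdn]
  refine (h.norm_step_le hc le_rfl hr hd).trans_eq ?_
  rw [h.consts.deriv_lam, neg_neg]
  ring

theorem step_ineq (h : NewtonSetting F C x₀ γ b θ lam κ)
    (hb : invNorm F C x₀ (-F x₀) ≤ b) {x : ℕ → X} (hx : IsNewtonSeq F C x₀ θ x) (k : ℕ) :
    ‖x (k + 1) - x (k + 2)‖ ≤ (1 + θ) / (1 - θ) *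
      ((1 + θ) / 2 * (2 * γ / (1 - γ * lam) ^ 3 / κ) * ‖x k - x (k + 1)‖ +
        θ * ((2 - κ) / κ)) * ‖x k - x (k + 1)‖ := by
  have hc := (Controlled.norm_lt h (h.controlled hb hx k)).le
  have h1 := h.norm_sub_le_invNorm hb hx (k + 1)
  have h2 := h.invNorm_succ_le hb hx k
  obtain ⟨r, d, hr, hd, hxd⟩ := hx.2 k
  have h3 := h.invNorm_le_step hc hr hd
  have hdn : ‖x k - x (k + 1)‖ = ‖d‖ := by rw [hxd]; simp
  rw [hdn] at h2 ⊢
  have hγ := h.consts.γ_pos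
  have hθ := h.consts.θ_nonneg
  have hθ1 : 0 < 1 - θ := by linarith [h.consts.θ_lt_one]
  have hκ := h.consts.κ_pos
  have hM : 0 < γ / (1 - γ * lam) ^ 3 := by
    have : 0 < 1 - γ * lam := by linarith [h.consts.γ_lam]
    positivity
  have e : 2 * γ / (1 - γ * lam) ^ 3 = 2 * (γ / (1 - γ * lam) ^ 3) := by ring
  rw [e]
  set M := γ / (1 - γ * lam) ^ 3
  have h4 : invNorm F C x₀ (-F (x k)) ≤ (2 - κ) * ‖d‖ / (1 - θ) := by
    rw [le_div_iff₀ hθ1, mul_comm]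
    exact h3
  -- The factor `(1 + θ) / (1 - θ) ≥ 1` is given away to reach the stated form.
  have h5 : M * ‖d‖ ^ 2 ≤ (1 + θ) / (1 - θ) * (M * ‖d‖ ^ 2) := by
    refine le_mul_of_one_le_left (by positivity) ?_
    rw [one_le_div hθ1]
    linarith
  calc ‖x (k + 1) - x (k + 2)‖
      ≤ (1 + θ) / κ * (θ * ((2 - κ) * ‖d‖ / (1 - θ)) + (1 + θ) / (1 - θ) * (M * ‖d‖ ^ 2)) := by
        refine h1.trans ?_
        gcongr
        exact h2.trans (add_le_add (mul_le_mul_of_nonneg_left h4 hθ) h5)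
    _ = _ := by
        field_simp
        ring

theorem exists_limit (h : NewtonSetting F C x₀ γ b θ lam κ)
    (hb : invNorm F C x₀ (-F x₀) ≤ b) {x : ℕ → X} (hx : IsNewtonSeq F C x₀ θ x) :
    ∃ xs, Tendsto x atTop (𝓝 xs) ∧ ‖xs - x₀‖ ≤ lam ∧ F xs ∈ C := by
  have hstep : ∀ k, dist (x k) (x (k + 1)) ≤ (majSeq γ b θ (k + 1)).1 - (majSeq γ b θ k).1 :=
    fun k => by
      rw [dist_eq_norm]
      exact (h.controlled_succ (h.controlled hb hx k) (hx.2 k)).2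
  have hsum : Summable fun k => (majSeq γ b θ (k + 1)).1 - (majSeq γ b θ k).1 := by
    refine summable_of_sum_range_le (c := lam) (fun k => dist_nonneg.trans (hstep k)) fun n => ?_
    rw [Finset.sum_range_sub fun k => (majSeq γ b θ k).1]
    have := (h.consts.majSeq_spec n).2.1
    simp only [majSeq]
    linarith
  obtain ⟨xs, hxs⟩ := cauchySeq_tendsto_of_complete (cauchySeq_of_dist_le_of_summable _ hstep hsum)
  have hball : ‖xs - x₀‖ ≤ lam :=
    le_of_tendsto' (hxs.sub_const x₀).norm fun k =>
      (Controlled.norm_lt h (h.controlled hb hx k)).le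
  refine ⟨xs, hxs, hball, ?_⟩
  -- The vectors `F'(x₀) (d k) + F (x k)` lie in `C` and `d k → 0`, so the limit `F xs` lies in the
  -- closed cone.
  choose d hd hdn using fun k => h.regular.exists_norm_eq (-F (x k))
  have hθ := h.consts.θ_nonneg
  have hθ1 := h.consts.θ_lt_one
  have hpow : Tendsto (fun k => ((1 + θ ^ 2) / 2) ^ k * b) atTop (𝓝 0) := by
    have := (tendsto_pow_atTop_nhds_zero_of_lt_one (r := (1 + θ ^ 2) / 2) (by positivity)
      (by nlinarith)).mul_const b
    rwa [zero_mul] at this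
  have hd0 : Tendsto d atTop (𝓝 0) := squeeze_zero_norm
    (fun k => (hdn k).trans_le (h.invNorm_le_pow hb hx k)) hpow
  have hF : Tendsto (fun k => F (x k)) atTop (𝓝 (F xs)) :=
    (h.hasFDerivAt (h.mem_ball_of_le hball)).continuousAt.tendsto.comp hxs
  have hlim := (((fderiv ℝ F x₀).continuous.tendsto 0).comp hd0).sub hF.neg
  rw [map_zero, zero_sub, neg_neg] at hlim
  exact h.regular.closed.mem_of_tendsto hlim (Eventually.of_forall hd)

/-- The distance to the limit eventually contracts at any rate above the asymptotic one. -/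
theorem eventually_norm_sub_le (h : NewtonSetting F C x₀ γ b θ lam κ)
    (hb : invNorm F C x₀ (-F x₀) ≤ b) {x : ℕ → X} (hx : IsNewtonSeq F C x₀ θ x) {xs : X}
    (hlim : Tendsto x atTop (𝓝 xs)) (hball : ‖xs - x₀‖ ≤ lam) (hF : F xs ∈ C)
    {θ' : ℝ} (hθ' : θ < θ') (hθ'1 : θ' < 1) :
    ∀ᶠ k in atTop, ‖xs - x (k + 1)‖ ≤ (1 + θ) / κ * (θ' / (1 - θ') * (2 - κ)) * ‖xs - x k‖ := by
  have hθ := h.consts.θ_nonneg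
  have hθ1 := h.consts.θ_lt_one
  have hκ := h.consts.κ_pos
  have hM : 0 < γ / (1 - γ * lam) ^ 3 := by
    have : 0 < 1 - γ * lam := by linarith [h.consts.γ_lam]
    have := h.consts.γ_pos
    positivity
  set M := γ / (1 - γ * lam) ^ 3
  have hQ0 : ∀ k, 0 ≤ invNorm F C x₀ (-F (x k)) := fun k => procNorm_nonneg _ _ _
  have hQ : Tendsto (fun k => M * ((1 + θ) / κ) ^ 2 * (((1 + θ ^ 2) / 2) ^ k * b)) atTop (𝓝 0) := by
    have := ((tendsto_pow_atTop_nhds_zero_of_lt_one (r := (1 + θ ^ 2) / 2) (by positivity)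
      (by nlinarith)).mul_const b).const_mul (M * ((1 + θ) / κ) ^ 2)
    rwa [zero_mul, mul_zero] at this
  -- The quadratic term in the residual recursion is at most `M ((1 + θ) / κ)² Q²`; beyond `K` it is
  -- at most `(θ' - θ) Q`.
  obtain ⟨K, hK⟩ := eventually_atTop.1 (hQ.eventually (gt_mem_nhds (sub_pos.2 hθ')))
  have hdec : ∀ k ≥ K, invNorm F C x₀ (-F (x (k + 1))) ≤ θ' * invNorm F C x₀ (-F (x k)) := by
    intro k hk
    set Q := invNorm F C x₀ (-F (x k)) with hQdef
    have h1 := h.invNorm_succ_le hb hx k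
    have h2 := pow_le_pow_left₀ (norm_nonneg _) (h.norm_sub_le_invNorm hb hx k) 2
    have h3 : M * ((1 + θ) / κ) ^ 2 * Q ≤ θ' - θ :=
      (mul_le_mul_of_nonneg_left (h.invNorm_le_pow hb hx k) (by positivity)).trans (hK k hk).le
    have h4 := mul_le_mul_of_nonneg_right h3 (hQ0 k)
    have h5 := mul_le_mul_of_nonneg_left h2 hM.le
    rw [← hQdef] at h1 h4 h5
    rw [mul_pow] at h5
    linarith
  filter_upwards [eventually_ge_atTop K] with k hk
  have hθ'0 : 0 ≤ θ' := hθ.trans hθ'.le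
  have hgeo : ∀ j, invNorm F C x₀ (-F (x (k + j))) ≤
      θ' ^ j * invNorm F C x₀ (-F (x k)) := by
    intro j
    induction j with
    | zero => simp
    | succ j ih =>
      refine (hdec (k + j) (by omega)).trans ?_
      rw [pow_succ', mul_assoc]
      exact mul_le_mul_of_nonneg_left ih hθ'0
  have hdist := dist_le_of_le_geometric_of_tendsto₀ θ'
    ((1 + θ) / κ * (θ' * invNorm F C x₀ (-F (x k)))) hθ'1
    (f := fun j => x (k + 1 + j)) (a := xs) (fun j => by
      rw [dist_eq_norm]
      refine (h.norm_sub_le_invNorm hb hx (k + 1 + j)).trans ?_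
      rw [mul_assoc]
      refine mul_le_mul_of_nonneg_left ?_ (by positivity)
      refine (show k + 1 + j = k + (j + 1) by omega) ▸ (hgeo (j + 1)).trans_eq (by ring))
    (hlim.comp (tendsto_add_atTop_nat (k + 1) |>.congr fun j => add_comm _ _))
  rw [add_zero, dist_comm, dist_eq_norm] at hdist
  refine hdist.trans ?_
  have hQk := h.invNorm_neg_apply_le (Controlled.norm_lt h (h.controlled hb hx k)).le hball hF
  have h1θ' : 0 < 1 - θ' := by linarith
  calc (1 + θ) / κ * (θ' * invNorm F C x₀ (-F (x k))) / (1 - θ')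
      ≤ (1 + θ) / κ * (θ' * ((2 - κ) * ‖xs - x k‖)) / (1 - θ') := by gcongr
    _ = _ := by ring

/-- The contraction rate at `θ' = θ` is strictly below the claimed constant, so by continuity some
`θ' > θ` still gives a rate below it. The bound holds for every admissible `θ`; the extra threshold
only makes it less than `1`. -/
theorem limsup_le (h : NewtonSetting F C x₀ γ b θ lam κ)
    (hb : invNorm F C x₀ (-F x₀) ≤ b) {x : ℕ → X} (hx : IsNewtonSeq F C x₀ θ x) {xs : X}
    (hlim : Tendsto x atTop (𝓝 xs)) (hball : ‖xs - x₀‖ ≤ lam) (hF : F xs ∈ C) :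
    limsup (fun k => ‖xs - x (k + 1)‖ₑ / ‖xs - x k‖ₑ) atTop ≤
      ENNReal.ofReal ((1 + θ) / (1 - θ) * ((1 + θ) / 2 + 2 * θ / κ)) := by
  have hθ := h.consts.θ_nonneg
  have hθ1 : 0 < 1 - θ := by linarith [h.consts.θ_lt_one]
  have hκ := h.consts.κ_pos
  set c := (1 + θ) / (1 - θ) * ((1 + θ) / 2 + 2 * θ / κ) with hc
  have hc0 : 0 ≤ c := by positivity
  have hlt : (1 + θ) / κ * (θ / (1 - θ) * (2 - κ)) < c := by
    have : (1 + θ) / κ * (θ / (1 - θ) * (2 - κ)) = (1 + θ) / (1 - θ) * (2 * θ / κ - θ) := by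
      field_simp
    rw [this]
    exact mul_lt_mul_of_pos_left (by linarith) (by positivity)
  have hcont : ContinuousAt (fun s : ℝ => (1 + θ) / κ * (s / (1 - s) * (2 - κ))) θ := by
    have : ContinuousAt (fun s : ℝ => s / (1 - s)) θ :=
      continuousAt_id.div (continuousAt_const.sub continuousAt_id) hθ1.ne'
    exact continuousAt_const.mul (this.mul continuousAt_const)
  have hev : ∀ᶠ s in 𝓝[>] θ, θ < s ∧ s < 1 ∧ (1 + θ) / κ * (s / (1 - s) * (2 - κ)) < c := by
    filter_upwards [self_mem_nhdsWithin,
      nhdsWithin_le_nhds (gt_mem_nhds h.consts.θ_lt_one),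
      nhdsWithin_le_nhds (hcont.eventually (gt_mem_nhds hlt))] with s h1 h2 h3
    exact ⟨h1, h2, h3⟩
  obtain ⟨θ', h1, h2, h3⟩ := hev.exists
  refine limsup_le_of_le ?_ ?_
  · isBoundedDefault
  · filter_upwards [h.eventually_norm_sub_le hb hx hlim hball hF h1 h2] with k hk
    -- No case split for `x k = xs`: the contraction then gives a zero numerator, and `0 / 0 = 0` in
    -- `ℝ≥0∞`.
    refine ENNReal.div_le_of_le_mul ?_
    rw [← ofReal_norm, ← ofReal_norm, ← ENNReal.ofReal_mul hc0]
    exact ENNReal.ofReal_le_ofReal (hk.trans (mul_le_mul_of_nonneg_right h3.le (norm_nonneg _)))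

end NewtonSetting

/-- The threshold on `θ` for linear convergence is the positive root of the quadratic
`(κ + 4) θ² + 4 (κ + 1) θ - κ`. -/
theorem rate_lt_one {s θ : ℝ} (hθ0 : 0 ≤ θ) (hθ1 : θ < 1) (hκ : 0 < 1 - 2 * s - s ^ 2)
    (hθ : θ < (-2 * (2 - 2 * s - s ^ 2) +
      √(5 * s ^ 4 - 44 * s + 20 * s ^ 2 * s - 2 * s ^ 2 + 21)) / (5 - 2 * s - s ^ 2)) :
    (1 + θ) / (1 - θ) * ((1 + θ) / 2 + 2 * θ / (1 - 2 * s - s ^ 2)) < 1 := by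
  set κ := 1 - 2 * s - s ^ 2 with hκdef
  have e1 : 5 * s ^ 4 - 44 * s + 20 * s ^ 2 * s - 2 * s ^ 2 + 21 = 5 * κ ^ 2 + 12 * κ + 4 := by
    rw [hκdef]
    ring
  rw [e1, show 2 - 2 * s - s ^ 2 = κ + 1 by rw [hκdef]; ring,
    show 5 - 2 * s - s ^ 2 = κ + 4 by rw [hκdef]; ring, lt_div_iff₀ (by linarith)] at hθ
  have h1 : θ * (κ + 4) + 2 * (κ + 1) < √(5 * κ ^ 2 + 12 * κ + 4) := by linarith
  have h2 := (Real.lt_sqrt (by positivity)).1 h1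
  -- Completing the square: the left side is `(θ (κ + 4) + 2 (κ + 1))² - (5 κ² + 12 κ + 4)`.
  have h3 : (κ + 4) * ((κ + 4) * θ ^ 2 + 4 * (κ + 1) * θ - κ) < 0 := by nlinarith
  have h4 : (κ + 4) * θ ^ 2 + 4 * (κ + 1) * θ - κ < 0 := by
    by_contra hcon
    exact absurd (mul_nonneg (by linarith : (0 : ℝ) ≤ κ + 4) (not_lt.1 hcon)) (not_le.2 h3)
  have hθ1' : 0 < 1 - θ := by linarith
  have e2 : (1 + θ) / (1 - θ) * ((1 + θ) / 2 + 2 * θ / κ) =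
      (1 + θ) * (κ * (1 + θ) + 4 * θ) / ((1 - θ) * (2 * κ)) := by
    field_simp
    ring
  rw [e2, div_lt_one (by positivity)]
  nlinarith

end Convergence

end ConeNewton

/-! ### Derivatives of the majorant and the main theorem -/

theorem smaleMajorant_deriv_eq {γ b t : ℝ} (ht : γ * t < 1) :
    deriv (smaleMajorant γ b) t = ConeNewton.majorantDeriv γ t :=
  (ConeNewton.hasDerivAt_smaleMajorant (by linarith)).deriv

theorem smaleMajorant_derivWithin_deriv_eq {γ b t : ℝ} (ht : γ * t < 1) :
    derivWithin (deriv (smaleMajorant γ b)) (Set.Iio t) t = 2 * γ / (1 - γ * t) ^ 3 := by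
  have hev : deriv (smaleMajorant γ b) =ᶠ[𝓝 t] ConeNewton.majorantDeriv γ := by
    have : ∀ᶠ s in 𝓝 t, γ * s < 1 :=
      (continuous_const.mul continuous_id).continuousAt.eventually (gt_mem_nhds ht)
    filter_upwards [this] with s hs using smaleMajorant_deriv_eq hs
  exact ((ConeNewton.hasDerivAt_majorantDeriv (by linarith)).congr_of_eventuallyEq
    hev).hasDerivWithinAt.derivWithin (uniqueDiffWithinAt_Iio t)

end

theorem theorem4 {X Y : Type*}
    [NormedAddCommGroup X] [NormedSpace ℝ X] [CompleteSpace X]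
    [NormedAddCommGroup Y] [NormedSpace ℝ Y] [CompleteSpace Y]
    -- `X` is reflexive
    (hX : Function.Surjective (NormedSpace.inclusionInDoubleDual ℝ X))
    (C : ConvexCone ℝ Y) (hCne : (C : Set Y).Nonempty) (hCcl : IsClosed (C : Set Y))
    (Ω : Set X) (F : X → Y) (x₀ : X) (hx₀ : x₀ ∈ Ω) (γ b θ lam : ℝ)
    (hRob : ConeNewton.Robinson F C x₀)
    (hSmale : ConeNewton.Smale F Ω C x₀ γ)
    (hb : 0 < b)
    (hFb : ConeNewton.setNorm (ConeNewton.Tinv F C x₀ (-F x₀)) ≤ ENNReal.ofReal b)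
    (hbγ : b * γ < 3 - 2 * √2)
    (hθ0 : 0 ≤ θ)
    (hθ : θ ≤ (1 - 2 * √(γ * b) - γ * b) / (1 + 2 * √(γ * b) + γ * b))
    (hlam : lam = b / (√(γ * b) + γ * b)) :
    -- The method is well defined: however the first `n` iterations have been chosen, the current
    -- iterate lies in the domain, and every admissible residual there admits a step.
    (∀ (n : ℕ) (x : ℕ → X), x 0 = x₀ →
      (∀ k < n, ConeNewton.IsIteration F C x₀ θ (x k) (x (k + 1))) →
        x n ∈ interior Ω ∧
        ∀ r : Y, ConeNewton.IsResidual F C x₀ θ (x n) r → ∃ d : X, ConeNewton.IsStep F C (x n) r d) ∧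
    (∃ x : ℕ → X, ConeNewton.IsNewtonSeq F C x₀ θ x) ∧
    -- Every sequence generated by the method has the following properties.
    (∀ x : ℕ → X, ConeNewton.IsNewtonSeq F C x₀ θ x →
      (∀ k, ConeNewton.setNorm (ConeNewton.Tinv F C x₀ (-F (x k))) ≤
        ENNReal.ofReal (((1 + θ ^ 2) / 2) ^ k * b)) ∧
      (∀ k, x k ∈ Metric.ball x₀ lam) ∧
      (∀ k, ‖x (k + 1) - x (k + 2)‖ ≤
        (1 + θ) / (1 - θ) *
          ((1 + θ) / 2 *
              (derivWithin (deriv (smaleMajorant γ b)) (Set.Iio lam) lam /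
                |deriv (smaleMajorant γ b) lam|) * ‖x k - x (k + 1)‖ +
            θ * ((2 + deriv (smaleMajorant γ b) lam) / |deriv (smaleMajorant γ b) lam|)) *
          ‖x k - x (k + 1)‖) ∧
      ∃ xs : X, xs ∈ Metric.closedBall x₀ lam ∧ xs ∈ Ω ∧ F xs ∈ C ∧
        Tendsto x atTop (𝓝 xs) ∧
        (θ < (-2 * (2 - 2 * √(γ * b) - γ * b) +
              √(5 * γ ^ 2 * b ^ 2 - 44 * √(γ * b) + 20 * (γ * b) * √(γ * b) - 2 * (γ * b) + 21)) /
            (5 - 2 * √(γ * b) - γ * b) →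
          (1 + θ) / (1 - θ) * ((1 + θ) / 2 + 2 * θ / (1 - 2 * √(γ * b) - γ * b)) < 1 ∧
          limsup (fun k => ‖xs - x (k + 1)‖ₑ / ‖xs - x k‖ₑ) atTop ≤
            ENNReal.ofReal
              ((1 + θ) / (1 - θ) * ((1 + θ) / 2 + 2 * θ / (1 - 2 * √(γ * b) - γ * b))))) := by
  have hreg : ConeNewton.RegularProcess (fderiv ℝ F x₀) C := by
    refine ⟨hX, ConeNewton.zero_mem_of_closed_cone hCne hCcl, hCcl, fun y => ?_⟩
    obtain ⟨d, hd⟩ := hRob y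
    exact ⟨d, (ConeNewton.mem_Tinv_iff F C x₀ d y).2 hd⟩
  have hconst := ConeNewton.constants_of_smale hSmale.pos hb hbγ hθ0 hθ hlam
  have hΩ : Metric.ball x₀ (1 / γ) ⊆ interior Ω :=
    interior_maximal hSmale.ball_subset Metric.isOpen_ball
  have h : ConeNewton.NewtonSetting F C x₀ γ b θ lam (1 - 2 * √(γ * b) - γ * b) :=
    ⟨hconst, hreg, hSmale.analyticOn.mono hΩ, ConeNewton.smaleScalar_of_smale hSmale hreg⟩
  have hb' : ConeNewton.invNorm F C x₀ (-F x₀) ≤ b := by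
    rwa [ConeNewton.setNorm_Tinv hreg, ENNReal.ofReal_le_ofReal_iff hb.le] at hFb
  have hγlam := hconst.γ_lam
  have hκ := hconst.κ_pos
  refine ⟨fun n x hx0 hit => ?_, h.exists_isNewtonSeq hb', fun x hx => ⟨fun k => ?_, fun k => ?_,
    fun k => ?_, ?_⟩⟩
  · have hlt := ConeNewton.NewtonSetting.Controlled.norm_lt h
      (h.controlled_of_prefix hb' hx0 hit n le_rfl)
    exact ⟨hΩ (h.mem_ball_of_le hlt.le), fun r _ => h.exists_isStep hlt.le r⟩
  · rw [ConeNewton.setNorm_Tinv hreg]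
    exact ENNReal.ofReal_le_ofReal (h.invNorm_le_pow hb' hx k)
  · exact mem_ball_iff_norm.2 (ConeNewton.NewtonSetting.Controlled.norm_lt h
      (h.controlled hb' hx k))
  · rw [smaleMajorant_derivWithin_deriv_eq hγlam, smaleMajorant_deriv_eq hγlam, hconst.deriv_lam,
      abs_neg, abs_of_pos hκ, ← sub_eq_add_neg]
    exact h.step_ineq hb' hx k
  · obtain ⟨xs, hlim, hball, hF⟩ := h.exists_limit hb' hx
    refine ⟨xs, mem_closedBall_iff_norm.2 hball, interior_subset (hΩ (h.mem_ball_of_le hball)), hF,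
      hlim, fun hθ' => ⟨?_, h.limsup_le hb' hx hlim hball hF⟩⟩
    have hs : γ * b = √(γ * b) ^ 2 := (Real.sq_sqrt (mul_pos hSmale.pos hb).le).symm
    have e : 5 * γ ^ 2 * b ^ 2 = 5 * √(γ * b) ^ 4 := by
      rw [show √(γ * b) ^ 4 = (√(γ * b) ^ 2) ^ 2 by ring, ← hs]
      ring
    rw [e] at hθ'
    -- With `γ b = s²`, threshold and rate become expressions in `s` alone.
    generalize √(γ * b) = s at hs hθ' hκ ⊢
    rw [hs] at hθ' hκ ⊢
    exact ConeNewton.rate_lt_one hθ0 hconst.θ_lt_one hκ hθ'
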